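/- **Theorem 3.3.** A permutation $\pi$ of $\{1,\dots,n\}$ is an involution if $\pi(\pi(i))=i$ for all $i$; it belongs to $\mathrm{Av}(4321)$ if it has no decreasing subsequence of length 4; and it is simple if every set of consecutive indices that $\pi$ maps onto a set of consecutive values is empty, a singleton, or all of $\{1,\dots,n\}$. Let $$\gamma(x,y)=\sum_{\sigma} x^{2t(\sigma)}y^{k(\sigma)},$$ where $\sigma$ runs over the simple involutions in $\mathrm{Av}(4321)$ of length greater than $2$, and $t(\sigma)$, $k(\sigma)$ are the numbers of transpositions and of fixed points of $\sigma$. Then, as formal power series over $\mathbb{Q}$, $$\gamma(x,y)=\frac12\left(\frac1{1+y}-2x^2(1+y)-\sqrt{-4+\frac4{1+x^2}+\frac1{(1+y)^2}}\right),$$ where the square root is the power series with constant term $1$. Only even powers of $x$ occur, and the expansion in powers of $y$ begins $$(x^6+x^8+3x^{10}+6x^{12}+\cdots)+(2x^4+5x^6+13x^8+\cdots)y+(3x^4+14x^6+54x^8+\cdots)y^2+(x^4+18x^6+\cdots)y^3+(10x^6+145x^8+\cdots)y^4+\cdots,$$ where each bracket is complete up to its last displayed power of $x$. Substituting $y=x$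 gives the generating function $\gamma(x)$ of the same involutions counted by length, $$\gamma(x)=\frac12\left(\frac1{1+x}-2x^2(1+x)-\sqrt{-4+\frac4{1+x^2}+\frac1{(1+x)^2}}\right),$$ again with the square root of constant term $1$, and $$\gamma(x)=2x^5+4x^6+6x^7+15x^8+31x^9+67x^{10}+155x^{11}+343x^{12}+787x^{13}+1829x^{14}+\cdots.$$ -/

import Mathlib

/-- `π` contains the pattern `σ`: some subsequence of `π` (read off at the increasing positions
`f 0 < f 1 < ⋯`) is order-isomorphic to `σ`. -/
def ContainsPattern {k n : ℕ} (σ : Equiv.Perm (Fin k)) (π : Equiv.Perm (Fin n)) : Prop :=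
  ∃ f : Fin k ↪o Fin n, ∀ i j : Fin k, σ i < σ j ↔ π (f i) < π (f j)

def AvoidsPattern {k n : ℕ} (σ : Equiv.Perm (Fin k)) (π : Equiv.Perm (Fin n)) : Prop :=
  ¬ ContainsPattern σ π

/-- The decreasing permutation `4321` (written `3210` on `{0, 1, 2, 3}`). -/
def perm4321 : Equiv.Perm (Fin 4) := Fin.revPerm

/-- An interval of `π`: a contiguous set of indices whose set of values is also contiguous.
(In `Fin n`, order-connected sets are exactly the contiguous ones.) -/
def IsPermInterval {n : ℕ} (π : Equiv.Perm (Fin n)) (s : Set (Fin n)) : Prop :=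
  s.OrdConnected ∧ (π '' s).OrdConnected

/-- A permutation is simple if its only intervals are the empty one, the singletons and the
whole index set. -/
def IsSimplePerm {n : ℕ} (π : Equiv.Perm (Fin n)) : Prop :=
  ∀ s : Set (Fin n), IsPermInterval π s → s.Subsingleton ∨ s = Set.univ

/-- The simple involutions of length `n` in `Av(4321)`, the trivial ones (of length at most `2`)
being left out. -/
def simpleInvolutions (n : ℕ) : Set (Equiv.Perm (Fin n)) :=
  {π | 2 < n ∧ Function.Involutive π ∧ AvoidsPattern perm4321 π ∧ IsSimplePerm π}

/-- The number of fixed points. -/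
def numFixed {n : ℕ} (π : Equiv.Perm (Fin n)) : ℕ :=
  (Finset.univ.filter fun i => π i = i).card

/-- The number of transpositions `(i, π i)`, `i < π i`, of an involution. -/
def numTranspositions {n : ℕ} (π : Equiv.Perm (Fin n)) : ℕ :=
  (Finset.univ.filter fun i => i < π i).card

/-- `γ(x, y)`, with `x` the variable `0` and `y` the variable `1`: an involution with `t`
transpositions and `k` fixed points, hence of length `2 t + k`, contributes `x ^ (2 t) * y ^ k`. -/
noncomputable def gammaXY : MvPowerSeries (Fin 2) ℚ := fun m =>
  ((({π ∈ simpleInvolutions (m 0 + m 1) |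
      2 * numTranspositions π = m 0 ∧ numFixed π = m 1}).ncard : ℕ) : ℚ)

/-- `γ(x)`: the involutions counted by length. -/
noncomputable def gammaX : PowerSeries ℚ :=
  PowerSeries.mk fun n => ((simpleInvolutions n).ncard : ℚ)

/-- The coefficient of `x ^ i * y ^ k`. -/
noncomputable def coeffXY (F : MvPowerSeries (Fin 2) ℚ) (i k : ℕ) : ℚ :=
  MvPowerSeries.coeff (Finsupp.single 0 i + Finsupp.single 1 k) F

/-! An involution avoids 4321 exactly when no transposition is nested in another
(`avoids_perm4321_iff`). Its left ends are then closed first in, first out, so the word recording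
which indices are left ends, fixed points and right ends determines it. A nonnesting involution of
length greater than 3 is simple exactly when every cut is crossed by a transposition (`Spanned`) and
there is no increasing bond (`BondFree`). Indeed a proper invariant interval contains only fixed
points, and two distinct intervals exchanged by the involution lead to a bond or to an invariant
interval of three points.

Both conditions can be tested while the word is read with a queue of pending left ends
(`acceptsWord_stepOf_iff`): a bond of two left ends reappears as a bond of their right ends. The
series of completions of a state is a product over the queue, since every entry but the first
becomes the head right after a right end (`completionSeries_cons`). The four possible factors
satisfy a polynomial system whose solution is a Catalan series, and the series `Z` of all accepted
words satisfies `(1 + x²) Z = (1 + y) (x² + (1 + x²) Z²)`.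

The accepted words of length at most 3 are those of 21 and 321, which have to be discarded, so `γ =
Z - x² - x² y`. Completing the square in the quadratic gives the closed form. The coefficients come
from a polynomial that satisfies the same quadratic modulo high powers of the variables. -/

/-! ### Step words and the queue of pending left ends -/

/-- The type of an index of an involution: left end of a transposition, fixed point, right end. -/
inductive Step
  | up
  | flat
  | down
  deriving DecidableEq

namespace Step

instance : Fintype Step := ⟨{up, flat, down}, fun a => by cases a <;> simp⟩

/-- The variable by which a step is counted. -/
def var : Step → Fin 2
  | up => 0
  | flat => 1
  | down => 0

theorem sum_univ {M : Type*} [AddCommMonoid M] (g : Step → M) :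
    ∑ a, g a = g up + g flat + g down := by
  rw [show (Finset.univ : Finset Step) = {up, flat, down} from rfl,
    Finset.sum_insert (by decide),
    Finset.sum_insert (by decide), Finset.sum_singleton, add_assoc]

end Step

/-- `Accepts q l w`: the word `w` may follow a word with last letter `l` after which the pending
left ends are described by `q`. An entry of `q` is `true` if the left end is directly preceded by
another left end. Right ends close the pending left ends first in, first out, and increasing bonds
are forbidden. The word stops as soon as no left end is pending. -/
def Accepts : List Bool → Step → List Step → Prop
  | [], _, w => w = []
  | _ :: _, _, [] => False
  | m :: q, l, .up :: w => Accepts (m :: q ++ [decide (l = .up)]) .up w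
  | m :: q, l, .flat :: w => l ≠ .flat ∧ Accepts (m :: q) .flat w
  | m :: q, l, .down :: w => ¬(l = .down ∧ m = true) ∧ Accepts q .down w

/-- The words of bond-free indecomposable nonnesting involutions. -/
def AcceptsWord : List Step → Prop
  | .up :: w => Accepts [false] .up w
  | _ => False

theorem Accepts.count {q : List Bool} {l : Step} {w : List Step} (h : Accepts q l w) :
    w.count .down = q.length + w.count .up := by
  induction w generalizing q l with
  | nil => cases q <;> simp_all [Accepts]
  | cons a w ih =>
    cases q with
    | nil => simp [Accepts] at h
    | cons m q =>
      cases a <;> simp only [Accepts] at h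
      · have := ih h
        simp at this ⊢; omega
      · have := ih h.2
        simp at this ⊢; omega
      · have := ih h.2
        simp at this ⊢; omega

theorem Accepts.count_take {q : List Bool} {l : Step} {w : List Step} (h : Accepts q l w) (k : ℕ) :
    (w.take k).count .down ≤ q.length + (w.take k).count .up := by
  induction w generalizing q l k with
  | nil => simp
  | cons a w ih =>
    cases k with
    | zero => simp
    | succ k =>
    cases q with
    | nil => simp [Accepts] at h
    | cons m q =>
      cases a <;> simp only [Accepts] at h
      · have := ih h k
        simp at this ⊢; omega
      · have := ih h.2 k
        simp at this ⊢; omega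
      · have := ih h.2 k
        simp at this ⊢; omega

/-- With `AcceptsWord.count_take`, this is the ballot condition under which
`exists_nonNesting_stepOf_eq` builds an involution from the word. -/
theorem AcceptsWord.count {w : List Step} (h : AcceptsWord w) : w.count .down = w.count .up := by
  match w, h with
  | .up :: w, h =>
    have := Accepts.count h
    simp at this ⊢; omega

theorem AcceptsWord.count_take {w : List Step} (h : AcceptsWord w) (k : ℕ) :
    (w.take k).count .down ≤ (w.take k).count .up := by
  match w, h, k with
  | _, _, 0 => simp
  | .up :: w, h, k + 1 =>
    have := Accepts.count_take h k
    simp at this ⊢; omega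

/-! ### Series of accepted words: recurrence and product formula -/

open scoped Classical in
/-- The accepted words of length `N`, counted by their letters. -/
noncomputable def acceptedSum (N : ℕ) (q : List Bool) (l : Step) : MvPowerSeries (Fin 2) ℚ :=
  ∑ v : Fin N → Step, if Accepts q l (List.ofFn v) then ∏ i, MvPowerSeries.X (v i).var else 0

theorem acceptedSum_zero_nil (l : Step) : acceptedSum 0 [] l = 1 := by
  simp [acceptedSum, Accepts]

theorem acceptedSum_zero_cons (m : Bool) (q : List Bool) (l : Step) :
    acceptedSum 0 (m :: q) l = 0 := by
  simp [acceptedSum, Accepts]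

theorem acceptedSum_succ_nil (N : ℕ) (l : Step) : acceptedSum (N + 1) [] l = 0 := by
  simp [acceptedSum, Accepts]

theorem sum_cons_steps {M : Type*} [AddCommMonoid M] (N : ℕ) (g : (Fin (N + 1) → Step) → M) :
    ∑ v, g v = ∑ a, ∑ v : Fin N → Step, g (Fin.cons a v) := by
  rw [← Fintype.sum_prod_type']
  exact (Fintype.sum_equiv (Fin.consEquiv fun _ => Step) _ _ fun _ => rfl).symm

open MvPowerSeries in
theorem acceptedSum_succ_cons (N : ℕ) (m : Bool) (q : List Bool) (l : Step) :
    acceptedSum (N + 1) (m :: q) l =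
      X 0 * acceptedSum N (m :: q ++ [decide (l = .up)]) .up
      + (if l ≠ .flat then X 1 * acceptedSum N (m :: q) .flat else 0)
      + (if ¬(l = .down ∧ m = true) then X 0 * acceptedSum N q .down else 0) := by
  classical
  simp only [acceptedSum]
  rw [sum_cons_steps, Step.sum_univ]
  simp only [List.ofFn_cons, Accepts, Fin.prod_univ_succ, Fin.cons_zero, Fin.cons_succ, Step.var]
  congr 1
  · congr 1
    · rw [Finset.mul_sum]
      exact Finset.sum_congr rfl fun v _ => by split_ifs <;> simp
    · split_ifs with h
      · rw [Finset.mul_sum]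
        exact Finset.sum_congr rfl fun v _ => by simp [h]
      · exact Finset.sum_eq_zero fun v _ => by simp [h]
  · by_cases h : l = .down ∧ m = true
    · simp [h]
    · simp only [h, not_false_eq_true, true_and, if_true, Finset.mul_sum]
      exact Finset.sum_congr rfl fun v _ => by split_ifs <;> simp

/-- Two series with the same terms of total degree `N`. -/
def AgreeAt (N : ℕ) (φ ψ : MvPowerSeries (Fin 2) ℚ) : Prop :=
  ∀ m : Fin 2 →₀ ℕ, m 0 + m 1 = N → MvPowerSeries.coeff m φ = MvPowerSeries.coeff m ψ

theorem AgreeAt.add {N : ℕ} {φ ψ φ' ψ' : MvPowerSeries (Fin 2) ℚ} (h : AgreeAt N φ ψ)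
    (h' : AgreeAt N φ' ψ') : AgreeAt N (φ + φ') (ψ + ψ') := fun m hm => by
  simp [h m hm, h' m hm]

open MvPowerSeries in
theorem AgreeAt.X_mul {N : ℕ} {φ ψ : MvPowerSeries (Fin 2) ℚ} (h : AgreeAt N φ ψ) (s : Fin 2) :
    AgreeAt (N + 1) (X s * φ) (X s * ψ) := fun m hm => by
  classical
  rw [X, coeff_monomial_mul, coeff_monomial_mul]
  split_ifs with hle
  · rw [h]
    have hs : 1 ≤ m s := by simpa using hle s
    fin_cases s
    · simp at hs ⊢; omega
    · simp at hs ⊢; omega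
  · rfl

/-- The factor of a pending left end in `completionSeries`. -/
def markWeight {R : Type*} (A B : R) : Bool → R
  | false => A
  | true => B

/-- The series of the words that are accepted after a given state. -/
def completionSeries {R : Type*} [CommRing R] (A B F E : R) : List Bool → Step → R
  | [], _ => 1
  | _ :: q, .up => E * (q.map (markWeight A B)).prod
  | _ :: q, .flat => F * (q.map (markWeight A B)).prod
  | m :: q, .down => markWeight A B m * (q.map (markWeight A B)).prod

theorem completionSeries_down {R : Type*} [CommRing R] (A B F E : R) (q : List Bool) :
    completionSeries A B F E q .down = (q.map (markWeight A B)).prod := by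
  cases q <;> simp [completionSeries]

/-- The head of the queue contributes a factor depending on the last letter. After `.up` or `.flat`
its mark is irrelevant, because only a second consecutive `.down` can be forbidden; this gives `E`
and `F`. After `.down` an unmarked head may be closed at once and a marked one may not, whence `A =
B + x`. The later entries keep their factors `A` or `B`, since each becomes the head just after a
`.down`. The hypotheses are this first-letter analysis. -/
theorem completionSeries_cons {R : Type*} [CommRing R] {A B F E x y : R} (hA : A = B + x)
    (hB : B = x * A * E + y * F) (hF : F = x * A * E + x) (hE : E = x * B * E + y * F + x)
    (m : Bool) (q : List Bool) (l : Step) :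
    completionSeries A B F E (m :: q) l =
      x * completionSeries A B F E (m :: q ++ [decide (l = .up)]) .up
      + (if l ≠ .flat then y * completionSeries A B F E (m :: q) .flat else 0)
      + (if ¬(l = .down ∧ m = true) then x * completionSeries A B F E q .down else 0) := by
  rw [completionSeries_down]
  set g := (q.map (markWeight A B)).prod with hg
  cases l
  · simp [completionSeries, markWeight, ← hg]
    linear_combination g * hE
  · simp [completionSeries, markWeight, ← hg]
    linear_combination g * hF
  · cases m
    · simp [completionSeries, markWeight, ← hg]
      linear_combination g * hB + g * hA
    · simp [completionSeries, markWeight, ← hg]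
      linear_combination g * hB

-- Every letter has degree 1, so words of length `N` account exactly for the terms of total degree
-- `N`, and both sides obey the same recurrence.
open MvPowerSeries in
theorem acceptedSum_agreeAt {A B F E : MvPowerSeries (Fin 2) ℚ} (hA : A = B + X 0)
    (hB : B = X 0 * A * E + X 1 * F) (hF : F = X 0 * A * E + X 0)
    (hE : E = X 0 * B * E + X 1 * F + X 0) (N : ℕ) (q : List Bool) (l : Step) :
    AgreeAt N (acceptedSum N q l) (completionSeries A B F E q l) := by
  classical
  induction N generalizing q l with
  | zero =>
    intro m hm
    obtain rfl : m = 0 := by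
      ext i; fin_cases i
      · simp; omega
      · simp; omega
    cases q with
    | nil => simp [acceptedSum_zero_nil, completionSeries]
    | cons b q =>
      -- Unfolding once exhibits a factor `x` or `y` in every term, so the constant coefficient
      -- vanishes.
      rw [acceptedSum_zero_cons, completionSeries_cons hA hB hF hE]
      split_ifs <;> simp
  | succ N ih =>
    cases q with
    | nil =>
      intro m hm
      rw [acceptedSum_succ_nil, completionSeries, coeff_one, if_neg]
      · simp
      · rintro rfl; simp at hm
    | cons b q =>
      rw [acceptedSum_succ_cons, completionSeries_cons hA hB hF hE]
      refine (((ih _ _).X_mul 0).add ?_).add ?_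
      · split_ifs
        · exact (ih _ _).X_mul 1
        · exact fun _ _ => rfl
      · split_ifs
        · exact fun _ _ => rfl
        · exact (ih _ _).X_mul 0

/-- `C` is the Catalan series evaluated at `b`. -/
theorem exists_catalan_solution {σ : Type*} (b : MvPowerSeries σ ℚ)
    (hb : MvPowerSeries.constantCoeff b = 0) : ∃ C : MvPowerSeries σ ℚ, C = b * C ^ 2 + 1 := by
  have hs : PowerSeries.HasSubst b := .of_constantCoeff_zero hb
  have h := congrArg (PowerSeries.substAlgHom (R := ℚ) hs)
    (congrArg (PowerSeries.map (Nat.castRingHom ℚ)) PowerSeries.catalanSeries_sq_mul_X_add_one)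
  simp only [map_add, map_mul, map_pow, map_one, PowerSeries.map_X, PowerSeries.substAlgHom_X] at h
  exact ⟨_, by rw [mul_comm]; exact h.symm⟩

open scoped Classical in
/-- The accepted full words of length `n`. -/
noncomputable def wordSum (n : ℕ) : MvPowerSeries (Fin 2) ℚ :=
  ∑ v : Fin n → Step, if AcceptsWord (List.ofFn v) then ∏ i, MvPowerSeries.X (v i).var else 0

theorem wordSum_zero : wordSum 0 = 0 := by simp [wordSum, AcceptsWord]

theorem wordSum_succ (n : ℕ) :
    wordSum (n + 1) = MvPowerSeries.X 0 * acceptedSum n [false] .up := by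
  classical
  rw [wordSum, sum_cons_steps, Step.sum_univ]
  simp only [List.ofFn_cons, AcceptsWord, if_false, Finset.sum_const_zero, add_zero, acceptedSum,
    Finset.mul_sum, Fin.prod_univ_succ, Fin.cons_zero, Fin.cons_succ, Step.var]
  exact Finset.sum_congr rfl fun v _ => by split_ifs <;> simp

open MvPowerSeries in
/-- The series of accepted words. -/
theorem exists_word_series : ∃ Z : MvPowerSeries (Fin 2) ℚ,
    constantCoeff Z = 0 ∧ (∀ N, AgreeAt N (wordSum N) Z) ∧
    (1 + X 0 ^ 2) * Z = (1 + X 1) * (X 0 ^ 2 + (1 + X 0 ^ 2) * Z ^ 2) := by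
  set x : MvPowerSeries (Fin 2) ℚ := X 0 with hx
  set y : MvPowerSeries (Fin 2) ℚ := X 1 with hy
  set c := (1 + x ^ 2)⁻¹ with hc
  have hcx : c * (1 + x ^ 2) = 1 := MvPowerSeries.inv_mul_cancel _ (by simp [hx])
  -- The system gives `A = (1 + y) F` and `(1 + x²) E = A`, that is `E = c A`. Then `F = x A E + x`
  -- becomes, with `F = x C`, the Catalan equation for `C`. A full word is an initial left end
  -- followed by a completion of factor `E`, so `Z = x E`.
  obtain ⟨C, hC⟩ := exists_catalan_solution ((1 + y) ^ 2 * x ^ 2 * c) (by simp [hx])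
  refine ⟨x * ((1 + y) * x * c * C), by simp [hx], ?_, ?_⟩
  · have h := acceptedSum_agreeAt (A := (1 + y) * x * C) (B := (1 + y) * x * C - x)
      (F := x * C) (E := (1 + y) * x * c * C) (by ring)
      (by linear_combination x * hC)
      (by linear_combination x * hC)
      (by linear_combination x * hC + (1 + y) * x * C * hcx)
    rintro (_ | N)
    · intro m hm
      obtain rfl : m = 0 := by
        ext i; fin_cases i
        · simp; omega
        · simp; omega
      simp [wordSum_zero, hx]
    · rw [wordSum_succ]
      simpa [completionSeries] using (h N [false] .up).X_mul 0
  · linear_combination ((1 + y) * x ^ 2 * C - (1 + y) ^ 3 * x ^ 4 * c * C ^ 2) * hcx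
      + (1 + y) * x ^ 2 * hC

/-! ### Simple involutions avoiding 4321: nonnesting, spanned, bond-free -/

/-- No transposition lies strictly below another one. -/
def NonNesting {n : ℕ} (π : Equiv.Perm (Fin n)) : Prop :=
  ∀ i j, i < j → j < π j → π i < π j

/-- Every cut of the positions is crossed by some transposition. -/
def Spanned {n : ℕ} (π : Equiv.Perm (Fin n)) : Prop :=
  ∀ k, 0 < k → k < n → ∃ i : Fin n, i.val < k ∧ k ≤ (π i).val

/-- No two consecutive positions carry increasing consecutive values. -/
def BondFree {n : ℕ} (π : Equiv.Perm (Fin n)) : Prop :=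
  ∀ i j : Fin n, j.val = i.val + 1 → (π j).val ≠ (π i).val + 1

theorem avoids_perm4321_iff {n : ℕ} {π : Equiv.Perm (Fin n)} (hπ : Function.Involutive π) :
    AvoidsPattern perm4321 π ↔ NonNesting π := by
  constructor
  · intro h i j hij hj
    by_contra hlt
    have hlt' : π j < π i := lt_of_le_of_ne (not_lt.1 hlt) fun e => hij.ne (π.injective e).symm
    refine h ⟨OrderEmbedding.ofStrictMono ![i, j, π j, π i] ?_, ?_⟩
    · refine Fin.strictMono_iff_lt_succ.2 fun a => ?_
      fin_cases a
      · exact hij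
      · exact hj
      · exact hlt'
    · have h1 := hij.trans hj
      have h2 := h1.trans hlt'
      have h3 := hj.trans hlt'
      intro a b
      fin_cases a <;> fin_cases b <;>
        simp [perm4321, hπ i, hπ j, hij, hj, hlt', h1, h2, h3, hij.le, hj.le, hlt'.le, h1.le, h2.le,
          h3.le]
  · rintro h ⟨f, hf⟩
    have lt (a b : Fin 4) (hab : a < b) : f a < f b := f.strictMono hab
    have gt (a b : Fin 4) (hab : a < b) : π (f b) < π (f a) :=
      (hf b a).1 (by simpa [perm4321] using hab)
    -- If the second position of the pattern is a left end, its transposition is nested in that of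
    -- the first; otherwise the third position is a right end, and its transposition is nested in
    -- that of the fourth.
    rcases lt_or_ge (f 1) (π (f 1)) with h1 | h1
    · exact lt_asymm (h _ _ (lt 0 1 (by decide)) h1) (gt 0 1 (by decide))
    · have h2 : π (f 2) < f 2 := ((gt 1 2 (by decide)).trans_le h1).trans (lt 1 2 (by decide))
      have := h _ _ (gt 2 3 (by decide)) (by rwa [hπ])
      rw [hπ, hπ] at this
      exact lt_asymm this (lt 2 3 (by decide))

theorem ordConnected_pair {n : ℕ} {i j : Fin n} (hij : j.val = i.val + 1) :
    ({i, j} : Set (Fin n)).OrdConnected := by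
  refine ⟨fun a ha b hb c hc => ?_⟩
  simp only [Set.mem_insert_iff, Set.mem_singleton_iff, Set.mem_Icc, Fin.ext_iff, Fin.le_def]
    at ha hb hc ⊢
  omega

theorem IsSimplePerm.not_interval_pair {n : ℕ} {π : Equiv.Perm (Fin n)} (h : IsSimplePerm π)
    (hn : 2 < n) {i j : Fin n} (hij : j.val = i.val + 1) :
    ¬(π '' {i, j}).OrdConnected := by
  intro hc
  have hne : i ≠ j := fun e => by rw [e] at hij; omega
  rcases h _ ⟨ordConnected_pair hij, hc⟩ with hs | hs
  · exact hne (hs (by simp) (by simp))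
  · have := congrArg Set.ncard hs
    rw [Set.ncard_pair hne, Set.ncard_univ, Nat.card_eq_fintype_card, Fintype.card_fin] at this
    omega

theorem IsSimplePerm.bondFree {n : ℕ} {π : Equiv.Perm (Fin n)} (h : IsSimplePerm π)
    (hn : 2 < n) : BondFree π := by
  intro i j hij hb
  refine h.not_interval_pair hn hij ?_
  rw [Set.image_pair]
  exact ordConnected_pair hb

theorem IsSimplePerm.three_lt {n : ℕ} {π : Equiv.Perm (Fin n)} (h : IsSimplePerm π)
    (hn : 2 < n) : 3 < n := by
  by_contra hn'
  obtain rfl : n = 3 := by omega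
  have key : ∀ σ : Equiv.Perm (Fin 3), ∃ i j : Fin 3, j.val = i.val + 1 ∧
      ((σ j).val = (σ i).val + 1 ∨ (σ i).val = (σ j).val + 1) := by decide
  obtain ⟨i, j, hij, hb⟩ := key π
  refine h.not_interval_pair hn hij ?_
  rw [Set.image_pair]
  rcases hb with hb | hb
  · exact ordConnected_pair hb
  · rw [Set.pair_comm]
    exact ordConnected_pair hb

/-- An uncrossed cut makes both of its sides invariant intervals, and as `n > 2` one of them is
proper with at least two elements. -/
theorem IsSimplePerm.spanned {n : ℕ} {π : Equiv.Perm (Fin n)} (h : IsSimplePerm π)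
    (hπ : Function.Involutive π) (hn : 2 < n) : Spanned π := by
  intro k hk hkn
  by_contra! hc
  have hlt : {i : Fin n | i.val < k}.OrdConnected :=
    ⟨fun a ha b hb c hc => lt_of_le_of_lt (Fin.le_def.1 hc.2) hb⟩
  have hge : {i : Fin n | k ≤ i.val}.OrdConnected :=
    ⟨fun a ha b hb c hc => le_trans (show k ≤ a.val from ha) (Fin.le_def.1 hc.1)⟩
  have hcge (i : Fin n) (hi : k ≤ i.val) : k ≤ (π i).val := by
    by_contra hlt'
    have := hc (π i) (by omega)
    rw [hπ] at this
    omega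
  have im1 : π '' {i : Fin n | i.val < k} = {i : Fin n | i.val < k} := by
    ext i
    exact ⟨by rintro ⟨j, hj, rfl⟩; exact hc j hj, fun hi => ⟨π i, hc i hi, hπ i⟩⟩
  have im2 : π '' {i : Fin n | k ≤ i.val} = {i : Fin n | k ≤ i.val} := by
    ext i
    exact ⟨by rintro ⟨j, hj, rfl⟩; exact hcge j hj, fun hi => ⟨π i, hcge i hi, hπ i⟩⟩
  have hk1 : k = 1 := by
    rcases h _ ⟨hlt, by rwa [im1]⟩ with hs | hs
    · by_contra hk1
      have := @hs ⟨0, by omega⟩ hk ⟨1, by omega⟩ (show 1 < k by omega)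
      simp at this
    · have : (⟨k, hkn⟩ : Fin n) ∈ {i : Fin n | i.val < k} := hs ▸ Set.mem_univ _
      simp at this
  rcases h _ ⟨hge, by rwa [im2]⟩ with hs | hs
  · have := @hs ⟨1, by omega⟩ (show k ≤ 1 by omega) ⟨2, by omega⟩ (show k ≤ 2 by omega)
    simp at this
  · have : (⟨0, by omega⟩ : Fin n) ∈ {i : Fin n | k ≤ i.val} := hs ▸ Set.mem_univ _
    simp at this
    omega

theorem exists_consecutive_of_not_subsingleton {n : ℕ} {s : Set (Fin n)} (hs : s.OrdConnected)
    (hne : ¬s.Subsingleton) : ∃ i ∈ s, ∃ j ∈ s, j.val = i.val + 1 := by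
  obtain ⟨a, ha, b, hb, hab⟩ : ∃ a ∈ s, ∃ b ∈ s, a < b := by
    rw [Set.not_subsingleton_iff] at hne
    obtain ⟨a, ha, b, hb, hab⟩ := hne
    rcases lt_or_gt_of_ne hab with h | h
    · exact ⟨a, ha, b, hb, h⟩
    · exact ⟨b, hb, a, ha, h⟩
  have hab' := Fin.lt_def.1 hab
  exact ⟨a, ha, ⟨a + 1, by omega⟩, hs.out ha hb ⟨Fin.le_def.2 (by simp), Fin.le_def.2 hab'⟩, rfl⟩

/-- A proper invariant interval of a spanned nonnesting involution consists of fixed points. -/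
theorem eq_of_mem_invariant_interval {n : ℕ} {π : Equiv.Perm (Fin n)}
    (hπ : Function.Involutive π) (hN : NonNesting π) (hS : Spanned π) {s : Set (Fin n)}
    (hs : s.OrdConnected) (hinv : ∀ i ∈ s, π i ∈ s) (hu : s ≠ Set.univ) {i : Fin n} (hi : i ∈ s) :
    π i = i := by
  suffices H : ∀ i ∈ s, ¬i < π i from
    le_antisymm (not_lt.1 (H i hi)) (by simpa [hπ i] using H _ (hinv i hi))
  clear i hi
  intro i hi hlt
  have hinv' (j : Fin n) (hj : j ∉ s) : π j ∉ s := fun h => hj (by simpa [hπ j] using hinv _ h)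
  obtain ⟨z, hz⟩ := (Set.ne_univ_iff_exists_notMem s).1 hu
  obtain ⟨a, ha, hmin⟩ := Set.exists_min_image s id s.toFinite ⟨i, hi⟩
  obtain ⟨b, hb, hmax⟩ := Set.exists_max_image s id s.toFinite ⟨i, hi⟩
  simp only [id] at hmin hmax
  -- On a side where a point is missing, the cut bounding `s` is crossed by a transposition. Neither
  -- of its ends lies in the invariant set `s`, so the transposition of `i` would be nested in it.
  rcases lt_or_ge z a with hza | hza
  · obtain ⟨j, hj, hj'⟩ := hS a (by have := Fin.lt_def.1 hza; omega) a.2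
    have hjs : j ∉ s := fun h => absurd (hmin j h) (not_le.2 hj)
    refine lt_asymm (hN j i (lt_of_lt_of_le hj (hmin i hi)) hlt) (lt_of_not_ge fun hle => ?_)
    exact hinv' j hjs (hs.out ha (hinv i hi) ⟨hj', hle⟩)
  · have hbz : b < z := lt_of_not_ge fun hle => hz (hs.out ha hb ⟨hza, hle⟩)
    obtain ⟨j, hj, hj'⟩ := hS (b + 1) (by omega) (by have := Fin.lt_def.1 hbz; omega)
    have hjb : j ≤ b := Fin.le_def.2 (by omega)
    have hbj : b < π j := Fin.lt_def.2 (by omega)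
    have hjs : j ∉ s := fun h => absurd (hmax _ (hinv j h)) (not_le.2 hbj)
    have hji : j < i := lt_of_not_ge fun hle => hjs (hs.out hi hb ⟨hle, hjb⟩)
    exact absurd ((hN j i hji hlt).trans_le (hmax _ (hinv i hi))) (not_lt.2 hbj.le)

/-- Two intervals that are exchanged by a bond-free spanned nonnesting involution. -/
theorem not_exchanged_intervals {n : ℕ} {π : Equiv.Perm (Fin n)} (hn : 3 < n)
    (hπ : Function.Involutive π) (hN : NonNesting π) (hS : Spanned π) (hB : BondFree π)
    {s t : Set (Fin n)} (hs : s.OrdConnected) (ht : t.OrdConnected) (hst : ∀ i, i ∈ s ↔ π i ∈ t)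
    (hne : ¬s.Subsingleton) {p q : Fin n} (hps : p ∈ s) (hpt : p ∉ t) (hqs : q ∉ s) (hqt : q ∈ t)
    (hpq : p < q) : False := by
  have hts (i : Fin n) : i ∈ t ↔ π i ∈ s := by rw [hst, hπ]
  have lt1 (a b : Fin n) (ha : a ∈ s) (ha' : a ∉ t) (hb : b ∈ t) : a < b := by
    by_contra hab
    rcases lt_or_ge q a with h | h
    · exact hqs (hs.out hps ha ⟨hpq.le, h.le⟩)
    · exact ha' (ht.out hb hqt ⟨not_lt.1 hab, h⟩)
  have lt2 (a b : Fin n) (ha : a ∈ s) (hb : b ∈ t) (hb' : b ∉ s) : a < b := by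
    by_contra hab
    rcases lt_or_ge b p with h | h
    · exact hpt (ht.out hb hqt ⟨h.le, hpq.le⟩)
    · exact hb' (hs.out hps ha ⟨h, not_lt.1 hab⟩)
  have hpp := lt1 p (π p) hps hpt ((hst p).1 hps)
  have hppt : π p ∈ t := (hst p).1 hps
  have hpps : π p ∉ s := fun h => hpt ((hts p).2 h)
  -- A left end in `s ∩ t` lies right of `p`, so its image lies right of `π p`; but that image is in
  -- `s`, which lies left of `π p`. A right end is excluded by passing to its image, also in `s ∩
  -- t`.
  have hfix (a : Fin n) (has : a ∈ s) (hat : a ∈ t) : π a = a := by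
    have key (a : Fin n) (has : a ∈ s) (hat : a ∈ t) : π a ≤ a := by
      by_contra h
      exact lt_asymm (hN p a (lt1 p a hps hpt hat) (not_le.1 h))
        (lt2 _ _ ((hts a).1 hat) hppt hpps)
    have := key (π a) ((hts a).1 hat) ((hst a).1 has)
    rw [hπ] at this
    exact le_antisymm (key a has hat) this
  have hmono (a b : Fin n) (hb : b ∈ s) (hbt : b ∉ t) (hab : a < b) : π a < π b :=
    hN a b hab (lt1 b (π b) hb hbt ((hst b).1 hb))
  have hd : (s \ t).Subsingleton := by
    by_contra hd
    have hc : (s \ t).OrdConnected := ⟨fun a ha b hb c hc =>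
      ⟨hs.out ha.1 hb.1 hc, fun hct => absurd (lt1 b c hb.1 hb.2 hct) (not_lt.2 hc.2)⟩⟩
    obtain ⟨i, hi, j, hj, hij⟩ := exists_consecutive_of_not_subsingleton hc hd
    have h1 : π i < π j := hmono i j hj.1 hj.2 (Fin.lt_def.2 (by omega))
    refine hB i j hij ?_
    -- A value `c` skipped between `π i` and `π j` would come from a position in `s \ t`, which
    -- monotonicity puts strictly between the consecutive `i` and `j`.
    by_contra hb
    have h1' := Fin.lt_def.1 h1
    let c : Fin n := ⟨π i + 1, by omega⟩
    have hic : π i < c := Fin.lt_def.2 (by simp [c])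
    have hcj : c < π j := Fin.lt_def.2 (by simp only [c]; omega)
    have hct : c ∈ t := ht.out ((hst i).1 hi.1) ((hst j).1 hj.1) ⟨hic.le, hcj.le⟩
    have hcs : c ∉ s := fun h => lt_asymm hic
      (lt2 c (π i) h ((hst i).1 hi.1) fun h' => hi.2 ((hts i).2 h'))
    have hes : π c ∈ s := (hts c).1 hct
    have het : π c ∉ t := fun h => hcs ((hst c).2 h)
    rcases lt_trichotomy (π c) i with h | h | h
    · have := hmono _ _ hi.1 hi.2 h
      rw [hπ] at this
      exact lt_asymm this hic
    · rw [← h, hπ] at hic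
      exact lt_irrefl _ hic
    · rcases eq_or_lt_of_le (show j ≤ π c from Fin.le_def.2 (by have := Fin.lt_def.1 h; omega))
        with h' | h'
      · rw [h', hπ] at hcj
        exact lt_irrefl _ hcj
      · have := hmono _ _ hes het h'
        rw [hπ] at this
        exact lt_asymm this hcj
  have hi : (s ∩ t).Subsingleton := by
    by_contra hi
    obtain ⟨i, hi, j, hj, hij⟩ := exists_consecutive_of_not_subsingleton (hs.inter ht) hi
    exact hB i j hij (by rw [hfix i hi.1 hi.2, hfix j hj.1 hj.2, hij])
  obtain ⟨f, hfs, hft⟩ : ∃ f, f ∈ s ∧ f ∈ t := by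
    by_contra! hf
    exact hne fun a ha b hb => hd ⟨ha, hf a ha⟩ ⟨hb, hf b hb⟩
  have hpf : p < f := lt1 p f hps hpt hft
  have hfp : f < π p := lt2 f (π p) hfs hppt hpps
  have hs' (a : Fin n) (ha : a ∈ s) : a = p ∨ a = f := by
    by_cases hat : a ∈ t
    · exact Or.inr (hi ⟨ha, hat⟩ ⟨hfs, hft⟩)
    · exact Or.inl (hd ⟨ha, hat⟩ ⟨hps, hpt⟩)
  have ht' (a : Fin n) (ha : a ∈ t) : a = π p ∨ a = f := by
    rcases hs' (π a) ((hts a).1 ha) with h | h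
    · exact Or.inl (by rw [← h, hπ])
    · exact Or.inr (by rw [← hπ a, h, hfix f hfs hft])
  -- Now `s = {p, f}` and `t = {f, π p}`. Their union is an invariant interval that moves `p`, and
  -- it is proper because `n > 3`.
  have hv : ({p, f, π p} : Set (Fin n)).OrdConnected := by
    refine ⟨fun a ha b hb c hc => ?_⟩
    have hpc : p ≤ c := by
      refine le_trans ?_ hc.1
      rcases ha with rfl | rfl | rfl
      exacts [le_rfl, hpf.le, hpp.le]
    have hcp : c ≤ π p := by
      refine le_trans hc.2 ?_
      rcases hb with rfl | rfl | rfl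
      exacts [hpp.le, hfp.le, le_rfl]
    rcases le_total c f with h | h
    · rcases hs' c (hs.out hps hfs ⟨hpc, h⟩) with rfl | rfl <;> simp
    · rcases ht' c (ht.out hft hppt ⟨h, hcp⟩) with rfl | rfl <;> simp
  refine hpp.ne' (eq_of_mem_invariant_interval hπ hN hS hv ?_ ?_ (i := p) (by simp))
  · rintro i (rfl | rfl | rfl)
    · simp
    · simp [hfix _ hfs hft]
    · simp [hπ p]
  · intro hu
    have h1 : ({p, f, π p} : Set (Fin n)).ncard ≤ 3 := by
      refine (Set.ncard_insert_le _ _).trans ?_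
      have := Set.ncard_insert_le f {π p}
      rw [Set.ncard_singleton] at this
      omega
    rw [hu, Set.ncard_univ, Nat.card_eq_fintype_card, Fintype.card_fin] at h1
    omega

/-- An interval equal to its image consists of fixed points, hence contains a bond. Otherwise,
having equal size, the interval and its image each contain a point missing from the other, and
`not_exchanged_intervals` applies to them in one order or the other. -/
theorem isSimplePerm_of_spanned_of_bondFree {n : ℕ} {π : Equiv.Perm (Fin n)} (hn : 3 < n)
    (hπ : Function.Involutive π) (hN : NonNesting π) (hS : Spanned π) (hB : BondFree π) :
    IsSimplePerm π := by
  rintro s ⟨hs, ht⟩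
  by_contra! hcon
  obtain ⟨hne, hu⟩ := hcon
  have hst (i : Fin n) : i ∈ s ↔ π i ∈ π '' s := (π.injective.mem_set_image).symm
  have hts (i : Fin n) : i ∈ π '' s ↔ π i ∈ s := by rw [hst, hπ]
  by_cases heq : π '' s = s
  · obtain ⟨i, hi, j, hj, hij⟩ := exists_consecutive_of_not_subsingleton hs (by simpa using hne)
    have hfix (i : Fin n) (hi : i ∈ s) : π i = i :=
      eq_of_mem_invariant_interval hπ hN hS hs (fun i hi => by rwa [← hts, heq]) hu hi
    exact hB i j hij (by rw [hfix i hi, hfix j hj, hij])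
  · have hcard : (π '' s).ncard = s.ncard := Set.ncard_image_of_injective s π.injective
    obtain ⟨p, hps, hpt⟩ : ∃ p ∈ s, p ∉ π '' s := by
      by_contra! h
      exact heq (Set.eq_of_subset_of_ncard_le h hcard.le).symm
    obtain ⟨q, hqt, hqs⟩ : ∃ q ∈ π '' s, q ∉ s := by
      by_contra! h
      exact heq (Set.eq_of_subset_of_ncard_le h hcard.ge)
    rcases lt_trichotomy p q with h | rfl | h
    · exact not_exchanged_intervals hn hπ hN hS hB hs ht hst (by simpa using hne) hps hpt hqs hqt h
    · exact hqs hps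
    · refine not_exchanged_intervals hn hπ hN hS hB ht hs hts (fun h => ?_) hqt hqs hpt hps h
      exact absurd (Set.subsingleton_of_image π.injective s h) (by simpa using hne)

theorem mem_simpleInvolutions_iff {n : ℕ} (hn : 3 < n) (π : Equiv.Perm (Fin n)) :
    π ∈ simpleInvolutions n ↔
      Function.Involutive π ∧ NonNesting π ∧ Spanned π ∧ BondFree π := by
  constructor
  · rintro ⟨h2, hπ, ha, hs⟩
    exact ⟨hπ, (avoids_perm4321_iff hπ).1 ha, hs.spanned hπ h2, hs.bondFree h2⟩
  · rintro ⟨hπ, hN, hS, hB⟩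
    exact ⟨by omega, hπ, (avoids_perm4321_iff hπ).2 hN,
      isSimplePerm_of_spanned_of_bondFree hn hπ hN hS hB⟩

theorem simpleInvolutions_eq_empty {n : ℕ} (hn : n ≤ 3) : simpleInvolutions n = ∅ :=
  Set.eq_empty_of_forall_notMem fun _ h => absurd (h.2.2.2.three_lt h.1) (not_lt.2 hn)

/-! ### Nonnesting involutions and their step words -/

/-- The type of an index of a permutation. -/
def stepOf {n : ℕ} (π : Equiv.Perm (Fin n)) (i : Fin n) : Step :=
  if i < π i then .up else if π i = i then .flat else .down

section stepOf

variable {n : ℕ} {π : Equiv.Perm (Fin n)} {i : Fin n}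

theorem stepOf_eq_up : stepOf π i = .up ↔ i < π i := by
  unfold stepOf; split_ifs <;> simp_all

theorem stepOf_eq_flat : stepOf π i = .flat ↔ π i = i := by
  unfold stepOf
  split_ifs with h h'
  · simp [h.ne']
  · simp [h']
  · simp [h']

theorem stepOf_eq_down : stepOf π i = .down ↔ π i < i := by
  unfold stepOf
  split_ifs with h h'
  · simp [h.le]
  · simp [h']
  · simp [lt_of_le_of_ne (not_lt.1 h) h']

end stepOf

/-- A nonnesting involution is determined by the types of its indices. -/
theorem NonNesting.eq_of_stepOf_eq {n : ℕ} {π σ : Equiv.Perm (Fin n)}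
    (hπ : Function.Involutive π) (hσ : Function.Involutive σ) (hN : NonNesting π)
    (hN' : NonNesting σ) (h : stepOf π = stepOf σ) : π = σ := by
  have hup (i : Fin n) : i < π i ↔ i < σ i := by rw [← stepOf_eq_up, h, stepOf_eq_up]
  have hdown (i : Fin n) : π i < i ↔ σ i < i := by rw [← stepOf_eq_down, h, stepOf_eq_down]
  let f : {i // i < π i} → {i // π i < i} := fun i => ⟨π i, by rw [hπ]; exact i.2⟩
  let g : {i // i < π i} → {i // π i < i} := fun i =>
    ⟨σ i, by rw [hdown, hσ, ← hup]; exact i.2⟩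
  have hf : StrictMono f := fun i j hij => hN i j hij j.2
  have hg : StrictMono g := fun i j hij => hN' i j hij ((hup j).1 j.2)
  have hfs : Function.Surjective f := fun j =>
    ⟨⟨π j, by rw [hπ]; exact j.2⟩, Subtype.ext (hπ j)⟩
  have hgs : Function.Surjective g := fun j =>
    ⟨⟨σ j, by rw [hup, hσ, ← hdown]; exact j.2⟩, Subtype.ext (hσ j)⟩
  -- Both involutions map left ends increasingly onto right ends, and there is only one order
  -- isomorphism between finite chains.
  have hfg : hf.orderIsoOfSurjective f hfs = hg.orderIsoOfSurjective g hgs :=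
    Subsingleton.elim _ _
  have key (i : Fin n) (hi : i < π i) : π i = σ i :=
    congrArg Subtype.val (show f ⟨i, hi⟩ = g ⟨i, hi⟩ from DFunLike.congr_fun hfg ⟨i, hi⟩)
  ext1 i
  rcases lt_trichotomy i (π i) with hi | hi | hi
  · exact key i hi
  · have : stepOf σ i = .flat := by rw [← h, stepOf_eq_flat, ← hi]
    rw [stepOf_eq_flat.1 this, ← hi]
  · have := key (π i) (by rwa [hπ])
    rw [hπ] at this
    rw [this, hσ, ← this]

theorem count_take_ofFn {n : ℕ} (v : Fin n → Step) (a : Step) (k : ℕ) :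
    ((List.ofFn v).take k).count a = (Finset.univ.filter fun i => v i = a ∧ i.val < k).card := by
  induction k with
  | zero => simp
  | succ k ih =>
    by_cases hk : k < n
    · rw [List.take_succ_eq_append_getElem (by simpa using hk), List.count_append, ih,
        List.getElem_ofFn, List.count_singleton]
      have hd : Disjoint (Finset.univ.filter fun i : Fin n => v i = a ∧ i.val < k)
          (Finset.univ.filter fun i : Fin n => v i = a ∧ i = ⟨k, hk⟩) := by
        rw [Finset.disjoint_filter]
        rintro i - ⟨-, h⟩ ⟨-, rfl⟩
        exact lt_irrefl _ h
      have hu : (Finset.univ.filter fun i : Fin n => v i = a ∧ i.val < k + 1) =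
          (Finset.univ.filter fun i : Fin n => v i = a ∧ i.val < k) ∪
          (Finset.univ.filter fun i : Fin n => v i = a ∧ i = ⟨k, hk⟩) := by
        ext i
        simp only [Finset.mem_filter, Finset.mem_univ, true_and, Finset.mem_union, Fin.ext_iff,
          ← and_or_left, Nat.lt_succ_iff_lt_or_eq]
      rw [hu, Finset.card_union_of_disjoint hd]
      congr 1
      by_cases ha : v ⟨k, hk⟩ = a
      · rw [Finset.card_eq_one.2 ⟨⟨k, hk⟩, ?_⟩]
        · simp [ha]
        · ext i
          simp only [Finset.mem_filter, Finset.mem_univ, true_and, Finset.mem_singleton]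
          exact ⟨And.right, by rintro rfl; exact ⟨ha, rfl⟩⟩
      · rw [Finset.card_eq_zero.2]
        · simp [ha]
        · refine Finset.filter_eq_empty_iff.2 ?_
          rintro i - ⟨h, rfl⟩
          exact ha h
    · rw [List.take_of_length_le (by simp; omega)]
      rw [List.take_of_length_le (by simp; omega)] at ih
      rw [ih]
      congr 1
      ext i
      have := i.2
      simp only [Finset.mem_filter, Finset.mem_univ, true_and]
      constructor <;> rintro ⟨h, -⟩ <;> exact ⟨h, by omega⟩

/-- A word whose prefixes contain at least as many left ends as right ends, with equality for the
whole word, comes from a nonnesting involution. -/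
theorem exists_nonNesting_stepOf_eq {n : ℕ} (v : Fin n → Step)
    (hbal : (List.ofFn v).count .down = (List.ofFn v).count .up)
    (hpre : ∀ k, ((List.ofFn v).take k).count .down ≤ ((List.ofFn v).take k).count .up) :
    ∃ π : Equiv.Perm (Fin n), Function.Involutive π ∧ NonNesting π ∧ stepOf π = v := by
  classical
  set U := Finset.univ.filter fun i => v i = .up with hU
  set D := Finset.univ.filter fun i => v i = .down with hD
  have hcard : D.card = U.card := by
    have h (a : Step) :
        (List.ofFn v).count a = (Finset.univ.filter fun i => v i = a).card := by
      have := count_take_ofFn v a n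
      rw [List.take_of_length_le (by simp)] at this
      simpa using this
    rw [hD, hU, ← h, ← h, hbal]
  have mU {i : Fin n} : i ∈ U ↔ v i = .up := by simp [hU]
  have mD {i : Fin n} : i ∈ D ↔ v i = .down := by simp [hD]
  -- The first left end is matched with the first right end, the second with the second, and so on.
  let e : U ≃o D := (U.orderIsoOfFin rfl).symm.trans (D.orderIsoOfFin hcard)
  -- Otherwise the prefix ending at `e u` contains the partners of all left ends up to `u`, hence
  -- more right ends than left ends, against `hpre`.
  have hlt (u : U) : (u : Fin n) < e u := by
    by_contra hle
    have hne : (u : Fin n) ≠ e u := fun h => by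
      have h1 := mU.1 u.2
      have h2 := mD.1 (e u).2
      rw [← h, h1] at h2
      cases h2
    have hlt : ((e u : D) : Fin n) < u := lt_of_le_of_ne (not_lt.1 hle) hne.symm
    have h1 := hpre ((e u : D) + 1 : ℕ)
    rw [count_take_ofFn, count_take_ofFn] at h1
    have h2 : (Finset.univ.filter fun i => v i = .up ∧ i.val < (e u : D) + 1).card <
        (Finset.univ.filter fun i => v i = .up ∧ i ≤ u).card := by
      refine Finset.card_lt_card ⟨fun i hi => ?_, fun hsub => ?_⟩
      · simp only [Finset.mem_filter, Finset.mem_univ, true_and] at hi ⊢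
        exact ⟨hi.1, (Fin.le_def.2 (by omega : i.val ≤ (e u : D).1)).trans hlt.le⟩
      · have := hsub (Finset.mem_filter.2 ⟨Finset.mem_univ _, mU.1 u.2, le_rfl⟩)
        simp only [Finset.mem_filter, Finset.mem_univ, true_and] at this
        have := Fin.lt_def.1 hlt
        omega
    have h3 : (Finset.univ.filter fun i => v i = .up ∧ i ≤ u).card ≤
        (Finset.univ.filter fun i => v i = .down ∧ i.val < (e u : D) + 1).card := by
      refine Finset.card_le_card_of_injOn (fun i => if h : i ∈ U then e ⟨i, h⟩ else i) ?_ ?_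
      · intro i hi
        simp only [Finset.coe_filter, Finset.mem_univ, true_and, Set.mem_ofPred_eq] at hi ⊢
        rw [dif_pos (mU.2 hi.1)]
        refine ⟨mD.1 (e _).2, Nat.lt_succ_of_le ?_⟩
        exact e.monotone (show (⟨i, mU.2 hi.1⟩ : U) ≤ u from hi.2)
      · intro i hi j hj hij
        simp only [Finset.coe_filter, Finset.mem_univ, true_and, Set.mem_ofPred_eq] at hi hj hij
        rw [dif_pos (mU.2 hi.1), dif_pos (mU.2 hj.1)] at hij
        exact congrArg Subtype.val (e.injective (Subtype.ext hij))
    omega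
  let p : Fin n → Fin n := fun i =>
    if h : i ∈ U then e ⟨i, h⟩ else if h : i ∈ D then e.symm ⟨i, h⟩ else i
  have hdisj {i : Fin n} (h : i ∈ D) : i ∉ U := fun h' => by
    have := (mU.1 h').symm.trans (mD.1 h)
    cases this
  have pU {i : Fin n} (h : i ∈ U) : p i = e ⟨i, h⟩ := dif_pos h
  have pD {i : Fin n} (h : i ∈ D) : p i = e.symm ⟨i, h⟩ := by
    simp only [p]
    rw [dif_neg (hdisj h), dif_pos h]
  have pF {i : Fin n} (h : i ∉ U) (h' : i ∉ D) : p i = i := by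
    simp only [p]
    rw [dif_neg h, dif_neg h']
  have hp : Function.Involutive p := by
    intro i
    by_cases h : i ∈ U
    · rw [pU h, pD (e _).2]
      simp
    · by_cases h' : i ∈ D
      · rw [pD h', pU (e.symm _).2]
        simp
      · rw [pF h h', pF h h']
  have pD_lt {i : Fin n} (h : i ∈ D) : p i < i := by
    have := hlt (e.symm ⟨i, h⟩)
    rw [pD h]
    simpa using this
  have pU_lt {i : Fin n} (h : i ∈ U) : i < p i := by
    rw [pU h]
    exact hlt ⟨i, h⟩
  have hUiff {i : Fin n} : i < p i ↔ i ∈ U := by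
    refine ⟨fun hi => ?_, pU_lt⟩
    by_contra h
    by_cases h' : i ∈ D
    · exact lt_asymm hi (pD_lt h')
    · rw [pF h h'] at hi
      exact lt_irrefl _ hi
  refine ⟨hp.toPerm p, hp, ?_, ?_⟩
  · intro i j hij hj
    change p i < p j
    change j < p j at hj
    by_cases h : i ∈ U
    · rw [pU h, pU (hUiff.1 hj)]
      exact e.strictMono (show (⟨i, h⟩ : U) < ⟨j, _⟩ from hij)
    · exact ((not_lt.1 fun hi => h (hUiff.1 hi)).trans_lt hij).trans hj
  · ext i
    cases hv : v i
    · exact stepOf_eq_up.2 (pU_lt (mU.2 hv))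
    · exact stepOf_eq_flat.2 (pF (by simp [mU, hv]) (by simp [mD, hv]))
    · exact stepOf_eq_down.2 (pD_lt (mD.2 hv))

/-! ### Acceptance of the word as spannedness and bond-freeness -/

/-- The left ends before position `k` whose right ends are not before `k`. -/
def pending {n : ℕ} (π : Equiv.Perm (Fin n)) (k : ℕ) : List (Fin n) :=
  (List.finRange n).filter fun j => j.val < k ∧ k ≤ (π j).val

/-- Whether an index is directly preceded by a left end. -/
noncomputable def isMarked {n : ℕ} (π : Equiv.Perm (Fin n)) (j : Fin n) : Bool :=
  open scoped Classical in decide (∃ i : Fin n, j.val = i.val + 1 ∧ i < π i)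

/-- The condition on consecutive positions that is checked by `Accepts`. -/
def LocallyFree {n : ℕ} (π : Equiv.Perm (Fin n)) (i j : Fin n) : Prop :=
  ¬(stepOf π i = .flat ∧ stepOf π j = .flat) ∧
    ¬(stepOf π i = .down ∧ stepOf π j = .down ∧ isMarked π (π j) = true)

section pending

variable {n : ℕ} {π : Equiv.Perm (Fin n)}

theorem mem_pending {k : ℕ} {j : Fin n} : j ∈ pending π k ↔ j.val < k ∧ k ≤ (π j).val := by
  simp [pending]

theorem pairwise_pending (k : ℕ) : (pending π k).Pairwise (· < ·) :=
  (List.pairwise_lt_finRange n).filter _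

theorem pending_length_eq_nil : pending π n = [] :=
  List.eq_nil_iff_forall_not_mem.2 fun j hj => by
    have := (mem_pending.1 hj).2
    omega

theorem pending_succ_of_up (hπ : Function.Involutive π) {k : Fin n} (h : k < π k) :
    pending π (k + 1) = pending π k ++ [k] := by
  refine (pairwise_pending _).eq_of_mem_iff ?_ fun j => ?_
  · rw [List.pairwise_append]
    refine ⟨pairwise_pending _, List.pairwise_singleton _ _, fun a ha b hb => ?_⟩
    rw [List.mem_singleton.1 hb]
    exact (mem_pending.1 ha).1
  · rw [List.mem_append, List.mem_singleton, mem_pending, mem_pending]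
    constructor
    · rintro ⟨h1, h2⟩
      rcases eq_or_ne j k with rfl | hjk
      · exact Or.inr rfl
      · exact Or.inl ⟨by have := Fin.val_ne_of_ne hjk; omega, by omega⟩
    · rintro (⟨h1, h2⟩ | rfl)
      · refine ⟨by omega, lt_of_le_of_ne h2 fun e => ?_⟩
        have : π j = k := Fin.ext e.symm
        rw [← this, hπ] at h
        rw [this] at h
        have := Fin.lt_def.1 h
        omega
      · exact ⟨by omega, h⟩

theorem pending_succ_of_flat {k : Fin n} (h : π k = k) : pending π (k + 1) = pending π k := by
  refine (pairwise_pending _).eq_of_mem_iff (pairwise_pending _) fun j => ?_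
  rw [mem_pending, mem_pending]
  rcases eq_or_ne j k with rfl | hjk
  · rw [h]; omega
  · have h1 := Fin.val_ne_of_ne hjk
    have h2 : (π j).val ≠ k := fun e => hjk (π.injective (by rw [h]; exact Fin.ext e))
    omega

theorem pending_of_down (hπ : Function.Involutive π) (hN : NonNesting π) {k : Fin n}
    (h : π k < k) : pending π k = π k :: pending π (k + 1) := by
  refine (pairwise_pending _).eq_of_mem_iff ?_ fun j => ?_
  · rw [List.pairwise_cons]
    refine ⟨fun j hj => lt_of_not_ge fun hle => ?_, pairwise_pending _⟩
    obtain ⟨h1, h2⟩ := mem_pending.1 hj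
    rcases eq_or_lt_of_le hle with rfl | hlt
    · rw [hπ] at h2; omega
    · have := hN j (π k) hlt (by rwa [hπ])
      rw [hπ] at this
      have := Fin.lt_def.1 this
      omega
  · rw [List.mem_cons, mem_pending, mem_pending]
    rcases eq_or_ne j (π k) with rfl | hj
    · rw [hπ]
      simpa using h
    · have h1 : (π j).val ≠ k := fun e => hj (by rw [← hπ j, Fin.ext e])
      rcases eq_or_ne j k with rfl | hjk
      · have := Fin.lt_def.1 h
        simp only [hj, false_or]
        omega
      · have := Fin.val_ne_of_ne hjk
        simp only [hj, false_or]
        omega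

theorem isMarked_eq_decide {i k : Fin n} (h : k.val = i.val + 1) :
    isMarked π k = decide (stepOf π i = .up) := by
  classical
  rw [isMarked, decide_eq_decide, stepOf_eq_up]
  constructor
  · rintro ⟨j, hj, hj'⟩
    obtain rfl : j = i := Fin.ext (by omega)
    exact hj'
  · exact fun h' => ⟨i, h, h'⟩

/-- Induction on the number `d` of unread letters. Once `l` has been read, the queue is `pending π
(l + 1)`; each further letter tests that the queue is nonempty and that one consecutive pair is
`LocallyFree`. -/
theorem accepts_pending_iff (hπ : Function.Involutive π) (hN : NonNesting π) (d : ℕ) :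
    ∀ l : Fin n, l.val + 1 + d = n →
      (Accepts ((pending π (l + 1)).map (isMarked π)) (stepOf π l)
          ((List.ofFn (stepOf π)).drop (l + 1)) ↔
        (∀ k, l.val < k → k < n → pending π k ≠ []) ∧
          ∀ i j : Fin n, l < j → j.val = i.val + 1 → LocallyFree π i j) := by
  induction d with
  | zero =>
    intro l hl
    have hln : l.val + 1 = n := hl
    rw [hln, pending_length_eq_nil, List.drop_of_length_le (by simp)]
    simp only [List.map_nil, Accepts, true_iff]
    refine ⟨fun k h1 h2 => by omega, fun i j h1 => ?_⟩
    have := Fin.lt_def.1 h1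
    omega
  | succ d ih =>
    intro l hl
    let k : Fin n := ⟨l + 1, by omega⟩
    have hk : k.val = l.val + 1 := rfl
    rw [← hk, List.drop_eq_getElem_cons (by simp), List.getElem_ofFn]
    simp only [Fin.eta]
    have ih' := ih k (by omega)
    have split1 : (∀ k, l.val < k → k < n → pending π k ≠ []) ↔ pending π k ≠ [] ∧
        ∀ i, k.val < i → i < n → pending π i ≠ [] := by
      constructor
      · exact fun h => ⟨h k (by omega) k.2, fun i hi => h i (by omega)⟩
      · rintro ⟨h1, h2⟩ i hi
        rcases eq_or_lt_of_le (show k.val ≤ i by omega) with rfl | h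
        · exact fun _ => h1
        · exact h2 i h
    have split2 : (∀ i j : Fin n, l < j → j.val = i.val + 1 → LocallyFree π i j) ↔
        LocallyFree π l k ∧ ∀ i j : Fin n, k < j → j.val = i.val + 1 → LocallyFree π i j := by
      constructor
      · exact fun h => ⟨h l k (Fin.lt_def.2 (by omega)) hk,
          fun i j hj => h i j (Fin.lt_def.2 (by have := Fin.lt_def.1 hj; omega))⟩
      · rintro ⟨h1, h2⟩ i j hj hij
        rcases eq_or_lt_of_le (show k ≤ j from Fin.le_def.2 hj) with rfl | h
        · obtain rfl : i = l := Fin.ext (by omega)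
          exact h1
        · exact h2 i j h hij
    rw [split1, split2]
    by_cases hnil : pending π k = []
    · simp [hnil, Accepts]
    obtain ⟨a, q, haq⟩ := List.exists_cons_of_ne_nil hnil
    rcases lt_trichotomy k (π k) with h | h | h
    · have hstep : stepOf π k = .up := stepOf_eq_up.2 h
      rw [pending_succ_of_up hπ h, hstep, List.map_append, List.map_singleton,
        isMarked_eq_decide hk, haq, List.map_cons] at ih'
      rw [hstep, haq, List.map_cons, Accepts, ih']
      simp [LocallyFree, hstep]
    · have hstep : stepOf π k = .flat := stepOf_eq_flat.2 h.symm
      rw [pending_succ_of_flat h.symm, hstep, haq, List.map_cons] at ih'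
      rw [hstep, haq, List.map_cons, Accepts, ih']
      simp [LocallyFree, hstep]
      tauto
    · have hstep : stepOf π k = .down := stepOf_eq_down.2 h
      rw [hstep] at ih'
      rw [hstep, pending_of_down hπ hN h, List.map_cons, Accepts, ih']
      simp [LocallyFree, hstep]
      tauto

/-- A bond at two left ends is carried by the involution to a bond at two right ends, so it suffices
to test pairs of fixed points and pairs of right ends. -/
theorem bondFree_iff_locallyFree (hπ : Function.Involutive π) (hN : NonNesting π) :
    BondFree π ↔ ∀ i j : Fin n, j.val = i.val + 1 → LocallyFree π i j := by
  constructor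
  · intro hB i j hij
    refine ⟨?_, ?_⟩
    · rintro ⟨h1, h2⟩
      rw [stepOf_eq_flat] at h1 h2
      exact hB i j hij (by rw [h1, h2, hij])
    · rintro ⟨h1, h2, h3⟩
      rw [stepOf_eq_down] at h1 h2
      simp only [isMarked, decide_eq_true_eq] at h3
      obtain ⟨u, hu, hu'⟩ := h3
      have huj : u < π j := Fin.lt_def.2 (by omega)
      have hlt : π u < j := by simpa [hπ j] using hN u (π j) huj (by rwa [hπ])
      refine hB u (π j) hu ?_
      rw [hπ, hij]
      congr 1
      -- First in, first out: `u` directly precedes `π j` among the left ends, so its partner is the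
      -- right end directly before `j`, which is `i`. Any other position of `π i` creates a nesting.
      by_contra hne
      have hui : π u < i := by
        refine lt_of_le_of_ne (Fin.le_def.2 ?_) fun h => hne (congrArg Fin.val h.symm)
        have := Fin.lt_def.1 hlt
        omega
      have hne1 : π i ≠ u := fun h => hui.ne (by rw [← h, hπ])
      have hne2 : π i ≠ π j := fun h => by
        have := congrArg Fin.val (π.injective h)
        omega
      rcases lt_or_gt_of_ne hne1 with h | h
      · have := hN _ _ h hu'
        rw [hπ] at this
        exact lt_asymm this hui
      · have h' : π j < π i :=
          lt_of_le_of_ne (Fin.le_def.2 (by have := Fin.lt_def.1 h; omega)) hne2.symm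
        have := hN _ _ h' (by rwa [hπ])
        rw [hπ, hπ] at this
        have := Fin.lt_def.1 this
        omega
  · intro hL i j hij hb
    rcases lt_trichotomy i (π i) with h | h | h
    · have hd1 : stepOf π (π i) = .down := stepOf_eq_down.2 (by rwa [hπ])
      have hd2 : stepOf π (π j) = .down := stepOf_eq_down.2 (by
        rw [hπ, Fin.lt_def]; have := Fin.lt_def.1 h; omega)
      refine (hL (π i) (π j) hb).2 ⟨hd1, hd2, ?_⟩
      rw [hπ, isMarked_eq_decide hij]
      simpa [stepOf_eq_up] using h
    · refine (hL i j hij).1 ⟨stepOf_eq_flat.2 h.symm, stepOf_eq_flat.2 (Fin.ext ?_)⟩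
      rw [hb, ← h, hij]
    · refine (hL i j hij).2 ⟨stepOf_eq_down.2 h, stepOf_eq_down.2 ?_, ?_⟩
      · have := Fin.lt_def.1 h
        exact Fin.lt_def.2 (by omega)
      · rw [isMarked_eq_decide hb]
        simpa [stepOf_eq_up, hπ i] using h

theorem spanned_iff_pending : Spanned π ↔ ∀ k, 0 < k → k < n → pending π k ≠ [] := by
  refine forall_congr' fun k => forall_congr' fun _ => forall_congr' fun _ => ?_
  simp only [← mem_pending]
  exact ⟨fun ⟨_, hi⟩ => List.ne_nil_of_mem hi, List.exists_mem_of_ne_nil _⟩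

end pending

/-- For `n ≤ 1` this fails: both conditions on the right are vacuous, but the word has no initial
left end. -/
theorem acceptsWord_stepOf_iff {n : ℕ} {π : Equiv.Perm (Fin n)} (hn : 1 < n)
    (hπ : Function.Involutive π) (hN : NonNesting π) :
    AcceptsWord (List.ofFn (stepOf π)) ↔ Spanned π ∧ BondFree π := by
  let z : Fin n := ⟨0, by omega⟩
  have hd : List.ofFn (stepOf π) = stepOf π z :: (List.ofFn (stepOf π)).drop 1 := by
    rw [← List.getElem_ofFn (f := stepOf π) (i := 0) (by simp; omega),
      ← List.drop_eq_getElem_cons, List.drop_zero]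
  have h1 : pending π 1 = if z < π z then [z] else [] := by
    refine (pairwise_pending _).eq_of_mem_iff (by split_ifs <;> simp) fun j => ?_
    rw [mem_pending]
    split_ifs with h
    · rw [List.mem_singleton]
      constructor
      · exact fun h' => Fin.ext (by simp [z]; omega)
      · rintro rfl
        exact ⟨by simp [z], h⟩
    · simp only [List.not_mem_nil, iff_false, not_and, not_le]
      intro hj
      obtain rfl : j = z := Fin.ext (by simp [z]; omega)
      have := not_lt.1 h
      exact Nat.lt_succ_of_le this
  have key := accepts_pending_iff hπ hN (n - 1) z (by simp [z]; omega)
  rw [hd]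
  by_cases h : z < π z
  · have hs : stepOf π z = .up := stepOf_eq_up.2 h
    have hz : z.val + 1 = 1 := rfl
    have hm : isMarked π z = false := by
      simp [isMarked, z]
    rw [hz, h1, if_pos h, hs, List.map_singleton, hm] at key
    rw [hs, AcceptsWord, key, spanned_iff_pending, bondFree_iff_locallyFree hπ hN]
    refine and_congr Iff.rfl ⟨fun H i j hij => H i j (Fin.lt_def.2 ?_) hij, fun H i j _ => H i j⟩
    simp [z]; omega
  · have hs : stepOf π z ≠ .up := fun hs => h (stepOf_eq_up.1 hs)
    refine iff_of_false (fun hA => ?_) fun hS => ?_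
    · revert hA hs
      cases stepOf π z <;> simp [AcceptsWord]
    · exact spanned_iff_pending.1 hS.1 1 one_pos hn (by rw [h1, if_neg h])

/-! ### Comparison of `γ(x, y)` with the series of words -/

open MvPowerSeries in
theorem coeff_X_pow_mul_X_pow (a b : ℕ) (m : Fin 2 →₀ ℕ) :
    coeff m (X 0 ^ a * X 1 ^ b : MvPowerSeries (Fin 2) ℚ) = if m 0 = a ∧ m 1 = b then 1 else 0 := by
  classical
  rw [X_pow_eq, X_pow_eq, monomial_mul_monomial, coeff_monomial, one_mul]
  refine if_congr ⟨fun h => by simp [h], fun h => ?_⟩ rfl rfl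
  ext i
  fin_cases i
  · simpa using h.1
  · simpa using h.2

open scoped Classical in
theorem coeff_wordSum (n : ℕ) (m : Fin 2 →₀ ℕ) :
    MvPowerSeries.coeff m (wordSum n) =
      ((Finset.univ.filter fun v : Fin n → Step => AcceptsWord (List.ofFn v) ∧
        m 0 = (Finset.univ.filter fun i => (v i).var = 0).card ∧
        m 1 = (Finset.univ.filter fun i => (v i).var = 1).card).card : ℚ) := by
  rw [wordSum, map_sum, Finset.card_filter, Nat.cast_sum]
  refine Finset.sum_congr rfl fun v _ => ?_
  have hv : (∏ i, MvPowerSeries.X (v i).var : MvPowerSeries (Fin 2) ℚ) =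
      MvPowerSeries.X 0 ^ (Finset.univ.filter fun i => (v i).var = 0).card *
      MvPowerSeries.X 1 ^ (Finset.univ.filter fun i => (v i).var = 1).card := by
    rw [← Finset.prod_fiberwise Finset.univ (fun i => (v i).var), Fin.prod_univ_two]
    congr 1 <;>
    · rw [← Finset.prod_const]
      exact Finset.prod_congr rfl fun i hi => by rw [(Finset.mem_filter.1 hi).2]
  by_cases h : AcceptsWord (List.ofFn v)
  · simp only [h, if_true, true_and]
    rw [hv, coeff_X_pow_mul_X_pow, Nat.cast_ite, Nat.cast_one, Nat.cast_zero]
  · simp [h]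

theorem Step.var_eq_zero {a : Step} : a.var = 0 ↔ a = .up ∨ a = .down := by
  cases a <;> simp [Step.var]

theorem Step.var_eq_one {a : Step} : a.var = 1 ↔ a = .flat := by
  cases a <;> simp [Step.var]

theorem card_var_eq_one {n : ℕ} (π : Equiv.Perm (Fin n)) :
    (Finset.univ.filter fun i => (stepOf π i).var = 1).card = numFixed π := by
  simp only [Step.var_eq_one, stepOf_eq_flat, numFixed]

theorem card_var_eq_zero {n : ℕ} {π : Equiv.Perm (Fin n)} (hπ : Function.Involutive π) :
    (Finset.univ.filter fun i => (stepOf π i).var = 0).card = 2 * numTranspositions π := by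
  simp only [Step.var_eq_zero, stepOf_eq_up, stepOf_eq_down, numTranspositions]
  rw [Finset.filter_or, Finset.card_union_of_disjoint, two_mul]
  · congr 1
    refine Finset.card_bij (fun i _ => π i) ?_ (fun i _ j _ h => π.injective h) ?_
    · intro i hi
      simpa [hπ i] using hi
    · intro i hi
      exact ⟨π i, by simpa [hπ i] using hi, hπ i⟩
  · exact Finset.disjoint_filter.2 fun i _ h h' => lt_asymm h h'

theorem two_mul_numTranspositions_add_numFixed {n : ℕ} {π : Equiv.Perm (Fin n)}
    (hπ : Function.Involutive π) : 2 * numTranspositions π + numFixed π = n := by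
  rw [← card_var_eq_zero hπ, ← card_var_eq_one, ← Finset.card_union_of_disjoint,
    ← Finset.filter_or]
  · rw [Finset.filter_true_of_mem fun i _ => Fin.exists_fin_two.1 ⟨_, rfl⟩]
    simp
  · exact Finset.disjoint_filter.2 fun i _ h h' => by simp [h] at h'

theorem coeff_gammaXY {n : ℕ} {m : Fin 2 →₀ ℕ} (hm : m 0 + m 1 = n) :
    MvPowerSeries.coeff m gammaXY =
      (({π ∈ simpleInvolutions n |
        2 * numTranspositions π = m 0 ∧ numFixed π = m 1}).ncard : ℚ) := by
  subst hm
  rfl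

/-- In length greater than `3`, simple involutions correspond to accepted words. -/
theorem coeff_gammaXY_eq_coeff_wordSum {n : ℕ} (hn : 3 < n) {m : Fin 2 →₀ ℕ}
    (hm : m 0 + m 1 = n) :
    MvPowerSeries.coeff m gammaXY = MvPowerSeries.coeff m (wordSum n) := by
  classical
  rw [coeff_gammaXY hm, coeff_wordSum, Nat.cast_inj, ← Set.ncard_coe_finset,
    ← Set.InjOn.ncard_image (f := stepOf)]
  · congr 1
    ext v
    simp only [Set.mem_image, Set.mem_ofPred_eq, mem_simpleInvolutions_iff hn, Finset.coe_filter,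
      Finset.mem_univ, true_and]
    constructor
    · rintro ⟨π, ⟨⟨hπ, hN, hS, hB⟩, h0, h1⟩, rfl⟩
      exact ⟨(acceptsWord_stepOf_iff (by omega) hπ hN).2 ⟨hS, hB⟩,
        by rw [card_var_eq_zero hπ, h0], by rw [card_var_eq_one, h1]⟩
    · rintro ⟨hA, h0, h1⟩
      obtain ⟨π, hπ, hN, rfl⟩ := exists_nonNesting_stepOf_eq v hA.count hA.count_take
      obtain ⟨hS, hB⟩ := (acceptsWord_stepOf_iff (by omega) hπ hN).1 hA
      exact ⟨π, ⟨⟨hπ, hN, hS, hB⟩, by rw [h0, card_var_eq_zero hπ], by rw [h1, card_var_eq_one]⟩,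
        rfl⟩
  · rintro π ⟨hπ, -⟩ σ ⟨hσ, -⟩ h
    rw [mem_simpleInvolutions_iff hn] at hπ hσ
    exact hπ.2.1.eq_of_stepOf_eq hπ.1 hσ.1 hσ.2.1 h

theorem wordSum_one : wordSum 1 = 0 := by
  simp [wordSum_succ, acceptedSum_zero_cons]

theorem wordSum_two : wordSum 2 = MvPowerSeries.X 0 ^ 2 * MvPowerSeries.X 1 ^ 0 := by
  simp [wordSum_succ, acceptedSum_succ_cons, acceptedSum_zero_cons, acceptedSum_zero_nil, pow_two]

theorem wordSum_three : wordSum 3 = MvPowerSeries.X 0 ^ 2 * MvPowerSeries.X 1 ^ 1 := by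
  simp [wordSum_succ, acceptedSum_succ_cons, acceptedSum_zero_cons, acceptedSum_zero_nil,
    acceptedSum_succ_nil]
  ring

open MvPowerSeries in
theorem gammaXY_eq_sub {Z : MvPowerSeries (Fin 2) ℚ} (hZ : ∀ N, AgreeAt N (wordSum N) Z) :
    gammaXY = Z - X 0 ^ 2 * X 1 ^ 0 - X 0 ^ 2 * X 1 ^ 1 := by
  ext m
  rw [map_sub, map_sub, coeff_X_pow_mul_X_pow, coeff_X_pow_mul_X_pow, ← hZ _ m rfl]
  by_cases hn : 3 < m 0 + m 1
  · rw [coeff_gammaXY_eq_coeff_wordSum hn rfl, if_neg (by omega), if_neg (by omega)]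
    ring
  · rw [coeff_gammaXY rfl, simpleInvolutions_eq_empty (by omega)]
    -- In length at most 3 there are no simple involutions, and the only words are those of 21 and
    -- 321, which the two subtracted monomials cancel.
    obtain h | h | h | h : m 0 + m 1 = 0 ∨ m 0 + m 1 = 1 ∨ m 0 + m 1 = 2 ∨ m 0 + m 1 = 3 := by
      omega
    · rw [h, wordSum_zero, if_neg (by omega), if_neg (by omega)]
      simp
    · rw [h, wordSum_one, if_neg (by omega), if_neg (by omega)]
      simp
    · rw [h, wordSum_two, coeff_X_pow_mul_X_pow, if_neg (by omega : ¬(m 0 = 2 ∧ m 1 = 1))]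
      simp
    · rw [h, wordSum_three, coeff_X_pow_mul_X_pow, if_neg (by omega : ¬(m 0 = 2 ∧ m 1 = 0))]
      simp

/-! ### Substituting `y = x` -/

theorem hasSubst_const_X :
    MvPowerSeries.HasSubst (fun _ : Fin 2 => (PowerSeries.X : PowerSeries ℚ)) :=
  MvPowerSeries.hasSubst_of_constantCoeff_zero fun _ => PowerSeries.constantCoeff_X

/-- As `2t + k = n`, the involutions of length `n` are sorted by the pairs `(2t, k)` on the
antidiagonal. -/
theorem coeff_gammaX_eq_sum (n : ℕ) : PowerSeries.coeff n gammaX =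
    ∑ m ∈ Finset.finsuppAntidiag (Finset.univ : Finset (Fin 2)) n,
      MvPowerSeries.coeff m gammaXY := by
  classical
  have hfin : (simpleInvolutions n).Finite := Set.toFinite _
  rw [gammaX, PowerSeries.coeff_mk, Set.ncard_eq_toFinset_card _ hfin,
    Finset.card_eq_sum_card_fiberwise (t := Finset.finsuppAntidiag (Finset.univ : Finset (Fin 2)) n)
      (f := fun π => Finsupp.single 0 (2 * numTranspositions π) + Finsupp.single 1 (numFixed π)),
    Nat.cast_sum]
  · refine Finset.sum_congr rfl fun m hm => ?_
    rw [Finset.mem_finsuppAntidiag, Fin.sum_univ_two] at hm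
    rw [coeff_gammaXY hm.1, ← Set.ncard_coe_finset]
    congr 2
    ext π
    simp only [Finset.coe_filter, Set.Finite.mem_toFinset, Set.mem_ofPred_eq]
    refine and_congr_right fun _ => ⟨fun h => ?_, fun h => ?_⟩
    · simp [← h]
    · ext i
      fin_cases i
      · simpa using h.1
      · simpa using h.2
  · intro π hπ
    have := two_mul_numTranspositions_add_numFixed ((hfin.mem_toFinset.1 hπ).2.1)
    simp [Finset.mem_finsuppAntidiag, this]

theorem subst_gammaXY :
    MvPowerSeries.subst (fun _ : Fin 2 => (PowerSeries.X : PowerSeries ℚ)) gammaXY = gammaX := by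
  classical
  ext n
  rw [coeff_gammaX_eq_sum, PowerSeries.coeff, MvPowerSeries.coeff_subst hasSubst_const_X]
  have hterm (m : Fin 2 →₀ ℕ) : MvPowerSeries.coeff (Finsupp.single () n)
      (m.prod fun _ e => (PowerSeries.X : PowerSeries ℚ) ^ e) =
      if m 0 + m 1 = n then 1 else 0 := by
    rw [Finsupp.prod_fintype _ _ fun _ => pow_zero _, Fin.prod_univ_two, ← pow_add]
    exact (PowerSeries.coeff_X_pow n _).trans (if_congr eq_comm rfl rfl)
  simp only [hterm]
  rw [finsum_eq_sum_of_support_subset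
    (s := Finset.finsuppAntidiag (Finset.univ : Finset (Fin 2)) n)]
  · refine Finset.sum_congr rfl fun m hm => ?_
    rw [Finset.mem_finsuppAntidiag, Fin.sum_univ_two] at hm
    rw [if_pos hm.1, smul_eq_mul, mul_one]
  · intro m hm
    rw [Finset.mem_coe, Finset.mem_finsuppAntidiag, Fin.sum_univ_two]
    refine ⟨?_, Finset.subset_univ _⟩
    by_contra h
    simp [h] at hm

/-! ### Completing the square, and the first coefficients -/

/-- Multiplied by `c d`, the quadratic reads `Z² = d Z - c x²`, with `c x² = 1 - c`. So `d - 2 Z` is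
the required root; its constant term is 1 when `Z` has none and `d` is the inverse of `1 + y`. -/
theorem sq_sub_two_mul_eq {R : Type*} [CommRing R] {x y Z c d : R} (hc : c * (1 + x ^ 2) = 1)
    (hd : d * (1 + y) = 1)
    (hZ : (1 + x ^ 2) * Z = (1 + y) * (x ^ 2 + (1 + x ^ 2) * Z ^ 2)) :
    (d - 2 * Z) ^ 2 = -4 + 4 * c + d ^ 2 := by
  linear_combination (-4 * c * d) * hZ + (4 * d * Z - 4 * d * (1 + y) * Z ^ 2 - 4) * hc
    + (-4 * Z ^ 2 - 4 * c * x ^ 2) * hd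

/-- The terms of the series of accepted words that are not divisible by `x ^ 14` or `y ^ 5`. -/
def wordTruncXY {R : Type*} [CommRing R] (x y : R) : R :=
  x ^ 2 + x ^ 6 + x ^ 8 + 3 • (x ^ 10) + 6 • (x ^ 12) + x ^ 2 * y + 2 • (x ^ 4 * y) + 5 • (x ^ 6 *
  y) + 13 • (x ^ 8 * y) + 35 • (x ^ 10 * y) + 96 • (x ^ 12 * y) + 3 • (x ^ 4 * y ^ 2) + 14 • (x ^
  6 * y ^ 2) + 54 • (x ^ 8 * y ^ 2) + 192 • (x ^ 10 * y ^ 2) + 655 • (x ^ 12 * y ^ 2) + x ^ 4 * y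
  ^ 3 + 18 • (x ^ 6 * y ^ 3) + 118 • (x ^ 8 * y ^ 3) + 592 • (x ^ 10 * y ^ 3) + 2605 • (x ^ 12 * y
  ^ 3) + 10 • (x ^ 6 * y ^ 4) + 145 • (x ^ 8 * y ^ 4) + 1124 • (x ^ 10 * y ^ 4) + 6690 • (x ^ 12 *
  y ^ 4)

/-- Only membership of the residue in the ideal generated by `x ^ 14` and `y ^ 5` matters; the
cofactors are a certificate for `ring`. -/
theorem wordTruncXY_equation {R : Type*} [CommRing R] (x y : R) :
    (1 + x ^ 2) * wordTruncXY x y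
      - (1 + y) * (x ^ 2 + (1 + x ^ 2) * wordTruncXY x y ^ 2) =
    x ^ 14 * (
      (-15 - 267 * y - 2178 * y ^ 2 - 10606 * y ^ 3 - 34330 * y ^ 4 - 63318 * y ^ 5 - 52044 * y ^
      6 - 29504 * y ^ 7 - 13478 * y ^ 8 - 3000 * y ^ 9) + x ^ 2 * (-21 - 423 * y - 3843 * y ^ 2 -
      21161 * y ^ 3 - 79050 * y ^ 4 - 185742 * y ^ 5 - 273286 * y ^ 6 - 258606 * y ^ 7 - 156137 *
      y ^ 8 - 46405 * y ^ 9) + x ^ 4 * (-25 - 575 * y - 6121 * y ^ 2 - 39939 * y ^ 3 - 178900 * y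
      ^ 4 - 554136 * y ^ 5 - 1152146 * y ^ 6 - 1572330 * y ^ 7 - 1333053 * y ^ 8 - 503265 * y ^ 9)
      + x ^ 6 * (-39 - 997 * y - 11845 * y ^ 2 - 87231 * y ^ 3 - 446490 * y ^ 4 - 1627816 * y ^ 5
      - 4177984 * y ^ 6 - 7315304 * y ^ 7 - 8058226 * y ^ 8 - 3663236 * y ^ 9) + x ^ 8 * (-57 -
      1611 * y - 21339 * y ^ 2 - 176249 * y ^ 3 - 1018920 * y ^ 4 - 4266112 * y ^ 5 - 12838706 * y
      ^ 6 - 26877156 * y ^ 7 - 35684702 * y ^ 8 - 18242596 * y ^ 9) + x ^ 10 * (-72 - 2220 * y -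
      32178 * y ^ 2 - 292498 * y ^ 3 - 1873095 * y ^ 4 - 8767605 * y ^ 5 - 29832623 * y ^ 6 -
      71307545 * y ^ 7 - 108427120 * y ^ 8 - 59795220 * y ^ 9) + x ^ 12 * (-36 - 1188 * y - 18228
      * y ^ 2 - 174096 * y ^ 3 - 1166485 * y ^ 4 - 5706495 * y ^ 5 - 20246955 * y ^ 6 - 50404825 *
      y ^ 7 - 79611000 * y ^ 8 - 44756100 * y ^ 9)) +
    y ^ 5 * (
      x ^ 6 * (-2) + x ^ 8 * (-97 - 27 * y - y ^ 2) + x ^ 10 * (-1253 - 589 * y - 117 * y ^ 2 - 20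
      * y ^ 3) + x ^ 12 * (-10056 - 6520 * y - 2476 * y ^ 2 - 770 * y ^ 3 - 100 * y ^ 4)) := by
  simp only [wordTruncXY, nsmul_eq_mul]
  push_cast
  ring

/-- The terms of degree less than `15` of the series of accepted words counted by length. -/
def wordTrunc {R : Type*} [CommRing R] (x : R) : R :=
  x ^ 2 + x ^ 3 + 2 • (x ^ 5) + 4 • (x ^ 6) + 6 • (x ^ 7) + 15 • (x ^ 8) + 31 • (x ^ 9) + 67 • (x
  ^ 10) + 155 • (x ^ 11) + 343 • (x ^ 12) + 787 • (x ^ 13) + 1829 • (x ^ 14)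

theorem wordTrunc_equation {R : Type*} [CommRing R] (x : R) :
    (1 + x ^ 2) * wordTrunc x - (1 + x) * (x ^ 2 + (1 + x ^ 2) * wordTrunc x ^ 2) =
    x ^ 15 * (
      -4233 - 9940 * x ^ 1 - 19221 * x ^ 2 - 28668 * x ^ 3 - 52244 * x ^ 4 - 93724 * x ^ 5 -
      173314 * x ^ 6 - 336242 * x ^ 7 - 634896 * x ^ 8 - 1193136 * x ^ 9 - 2212414 * x ^ 10 -
      3912826 * x ^ 11 - 6466486 * x ^ 12 - 9205022 * x ^ 13 - 8098150 * x ^ 14 - 6224087 * x ^ 15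
      - 3345241 * x ^ 16) := by
  simp only [wordTrunc, nsmul_eq_mul]
  push_cast
  ring

open MvPowerSeries in
theorem coeff_eq_coeff_wordTruncXY {Z : MvPowerSeries (Fin 2) ℚ} (hZ0 : constantCoeff Z = 0)
    (hZ : (1 + X 0 ^ 2) * Z = (1 + X 1) * (X 0 ^ 2 + (1 + X 0 ^ 2) * Z ^ 2))
    {m : Fin 2 →₀ ℕ} (h0 : m 0 < 14) (h1 : m 1 < 5) :
    coeff m Z = coeff m (wordTruncXY (X 0) (X 1)) := by
  set p : MvPowerSeries (Fin 2) ℚ := wordTruncXY (X 0) (X 1) with hp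
  -- Subtracting the quadratic expressions at `Z` and at `p` leaves `(Z - p) * U`. Since `U` has
  -- constant term 1 it is invertible, and `Z - p` lies in the ideal of the residue.
  set U : MvPowerSeries (Fin 2) ℚ :=
    (1 + X 0 ^ 2) - (1 + X 1) * (1 + X 0 ^ 2) * (Z + p) with hU
  have hUi : U * U⁻¹ = 1 := by
    refine MvPowerSeries.mul_inv_cancel _ ?_
    simp [hU, hp, hZ0, wordTruncXY]
  obtain ⟨a, b, hab⟩ : ∃ a b, (1 + X 0 ^ 2) * p - (1 + X 1) * (X 0 ^ 2 + (1 + X 0 ^ 2) * p ^ 2) =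
      X 0 ^ 14 * a + X 1 ^ 5 * b := ⟨_, _, wordTruncXY_equation _ _⟩
  have key : Z - p = X 0 ^ 14 * (-(a * U⁻¹)) + X 1 ^ 5 * (-(b * U⁻¹)) := by
    have : (Z - p) * U = -(X 0 ^ 14 * a + X 1 ^ 5 * b) := by
      rw [hU]
      linear_combination hZ - hab
    linear_combination U⁻¹ * this - (Z - p) * hUi
  rw [← sub_eq_zero, ← map_sub, key, map_add, X_pow_dvd_iff.1 (Dvd.intro _ rfl) m h0,
    X_pow_dvd_iff.1 (Dvd.intro _ rfl) m h1, add_zero]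

open PowerSeries in
theorem coeff_eq_coeff_wordTrunc {Z : PowerSeries ℚ} (hZ0 : constantCoeff Z = 0)
    (hZ : (1 + X ^ 2) * Z = (1 + X) * (X ^ 2 + (1 + X ^ 2) * Z ^ 2)) {n : ℕ} (hn : n < 15) :
    coeff n Z = coeff n (wordTrunc X) := by
  set p : PowerSeries ℚ := wordTrunc X with hp
  set U : PowerSeries ℚ := (1 + X ^ 2) - (1 + X) * (1 + X ^ 2) * (Z + p) with hU
  have hUi : U * U⁻¹ = 1 := by
    refine PowerSeries.mul_inv_cancel _ ?_
    simp [hU, hp, hZ0, wordTrunc]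
  obtain ⟨a, ha⟩ : ∃ a, (1 + X ^ 2) * p - (1 + X) * (X ^ 2 + (1 + X ^ 2) * p ^ 2) =
      X ^ 15 * a := ⟨_, wordTrunc_equation _⟩
  have key : Z - p = X ^ 15 * (-(a * U⁻¹)) := by
    have : (Z - p) * U = -(X ^ 15 * a) := by
      rw [hU]
      linear_combination hZ - ha
    linear_combination U⁻¹ * this - (Z - p) * hUi
  rw [← sub_eq_zero, ← map_sub, key, X_pow_dvd_iff.1 (Dvd.intro _ rfl) n hn]

theorem coeffXY_gammaXY {Z : MvPowerSeries (Fin 2) ℚ} (hZ0 : MvPowerSeries.constantCoeff Z = 0)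
    (hA : ∀ N, AgreeAt N (wordSum N) Z)
    (hZ : (1 + MvPowerSeries.X 0 ^ 2) * Z =
      (1 + MvPowerSeries.X 1) * (MvPowerSeries.X 0 ^ 2 + (1 + MvPowerSeries.X 0 ^ 2) * Z ^ 2))
    {i k : ℕ} (hi : i < 14) (hk : k < 5) :
    coeffXY gammaXY i k = coeffXY (wordTruncXY (MvPowerSeries.X 0) (MvPowerSeries.X 1)
      - MvPowerSeries.X 0 ^ 2 * MvPowerSeries.X 1 ^ 0
      - MvPowerSeries.X 0 ^ 2 * MvPowerSeries.X 1 ^ 1) i k := by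
  rw [coeffXY, gammaXY_eq_sub hA, map_sub, map_sub,
    coeff_eq_coeff_wordTruncXY hZ0 hZ (by simpa using hi) (by simpa using hk), ← map_sub,
    ← map_sub, coeffXY]

theorem coeffXY_X_pow_mul_X_pow (a b i k : ℕ) :
    coeffXY (MvPowerSeries.X 0 ^ a * MvPowerSeries.X 1 ^ b) i k =
      if i = a ∧ k = b then 1 else 0 := by
  rw [coeffXY, coeff_X_pow_mul_X_pow]
  simp

theorem coeffXY_X_pow (a i k : ℕ) :
    coeffXY (MvPowerSeries.X 0 ^ a) i k = if i = a ∧ k = 0 then 1 else 0 := by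
  rw [← coeffXY_X_pow_mul_X_pow, pow_zero, mul_one]

theorem coeffXY_X_pow_mul_X (a i k : ℕ) :
    coeffXY (MvPowerSeries.X 0 ^ a * MvPowerSeries.X 1) i k = if i = a ∧ k = 1 then 1 else 0 := by
  rw [← coeffXY_X_pow_mul_X_pow, pow_one]

theorem coeffXY_add (φ ψ : MvPowerSeries (Fin 2) ℚ) (i k : ℕ) :
    coeffXY (φ + ψ) i k = coeffXY φ i k + coeffXY ψ i k := map_add _ _ _

theorem coeffXY_sub (φ ψ : MvPowerSeries (Fin 2) ℚ) (i k : ℕ) :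
    coeffXY (φ - ψ) i k = coeffXY φ i k - coeffXY ψ i k := map_sub _ _ _

theorem coeffXY_nsmul (a : ℕ) (φ : MvPowerSeries (Fin 2) ℚ) (i k : ℕ) :
    coeffXY (a • φ) i k = a * coeffXY φ i k := by
  rw [coeffXY, map_nsmul, nsmul_eq_mul, coeffXY]

/-- The numbers of simple involutions with few fixed points. -/
theorem coeffXY_gammaXY_values :
    (List.range 7).map (fun j => coeffXY gammaXY (2 * j) 0) = [0, 0, 0, 1, 1, 3, 6] ∧
    (List.range 5).map (fun j => coeffXY gammaXY (2 * j) 1) = [0, 0, 2, 5, 13] ∧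
    (List.range 5).map (fun j => coeffXY gammaXY (2 * j) 2) = [0, 0, 3, 14, 54] ∧
    (List.range 4).map (fun j => coeffXY gammaXY (2 * j) 3) = [0, 0, 1, 18] ∧
    (List.range 5).map (fun j => coeffXY gammaXY (2 * j) 4) = [0, 0, 0, 10, 145] := by
  obtain ⟨Z, hZ0, hA, hZ⟩ := exists_word_series
  refine ⟨?_, ?_, ?_, ?_, ?_⟩ <;>
    -- Numerical factors must stay in the form `a • φ` for `coeffXY_nsmul` to extract them.
    simp [List.range_succ, coeffXY_gammaXY hZ0 hA hZ, wordTruncXY, coeffXY_add, coeffXY_sub,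
      coeffXY_nsmul, coeffXY_X_pow, coeffXY_X_pow_mul_X, coeffXY_X_pow_mul_X_pow, -nsmul_eq_mul]

theorem coeffXY_gammaXY_of_odd {i : ℕ} (hi : Odd i) (k : ℕ) : coeffXY gammaXY i k = 0 := by
  rw [coeffXY, coeff_gammaXY (n := i + k) (by simp), Nat.cast_eq_zero, Set.ncard_eq_zero]
  refine Set.eq_empty_of_forall_notMem ?_
  rintro π ⟨-, h, -⟩
  replace h : 2 * numTranspositions π = i := by simpa using h
  exact (Nat.not_even_iff_odd.2 hi) ⟨_, by rw [← h, two_mul]⟩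

open PowerSeries in
/-- The series of accepted words counted by length. -/
theorem exists_gammaX_eq_sub : ∃ z : PowerSeries ℚ, constantCoeff z = 0 ∧
    (1 + X ^ 2) * z = (1 + X) * (X ^ 2 + (1 + X ^ 2) * z ^ 2) ∧ gammaX = z - X ^ 2 - X ^ 3 := by
  obtain ⟨Z, hZ0, hA, hZ⟩ := exists_word_series
  have hs := hasSubst_const_X
  refine ⟨MvPowerSeries.substAlgHom (R := ℚ) hs Z, ?_, ?_, ?_⟩
  · rw [MvPowerSeries.substAlgHom_apply]
    exact MvPowerSeries.constantCoeff_subst_eq_zero hs (fun _ => PowerSeries.constantCoeff_X) hZ0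
  · have := congrArg (MvPowerSeries.substAlgHom (R := ℚ) hs) hZ
    simpa only [map_mul, map_add, map_pow, map_one, MvPowerSeries.substAlgHom_X] using this
  · have := congrArg (MvPowerSeries.substAlgHom (R := ℚ) hs) (gammaXY_eq_sub hA)
    rw [MvPowerSeries.substAlgHom_apply, subst_gammaXY] at this
    simp only [map_mul, map_sub, map_pow, MvPowerSeries.substAlgHom_X] at this
    rw [this]
    ring

theorem theorem3p3 :
    -- the closed form of `γ(x, y)`; `R` is the square root with constant term `1`
    (let x : MvPowerSeries (Fin 2) ℚ := MvPowerSeries.X 0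
     let y : MvPowerSeries (Fin 2) ℚ := MvPowerSeries.X 1
     ∃ R : MvPowerSeries (Fin 2) ℚ,
       MvPowerSeries.constantCoeff R = 1 ∧
       R ^ 2 = -4 + 4 * (1 + x ^ 2)⁻¹ + ((1 + y) ^ 2)⁻¹ ∧
       gammaXY = (1 / 2 : ℚ) • ((1 + y)⁻¹ - 2 * x ^ 2 * (1 + y) - R)) ∧
    -- the first terms of its expansion, for each power of `y`
    (∀ i k : ℕ, Odd i → coeffXY gammaXY i k = 0) ∧
    (List.range 7).map (fun j => coeffXY gammaXY (2 * j) 0) = [0, 0, 0, 1, 1, 3, 6] ∧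
    (List.range 5).map (fun j => coeffXY gammaXY (2 * j) 1) = [0, 0, 2, 5, 13] ∧
    (List.range 5).map (fun j => coeffXY gammaXY (2 * j) 2) = [0, 0, 3, 14, 54] ∧
    (List.range 4).map (fun j => coeffXY gammaXY (2 * j) 3) = [0, 0, 1, 18] ∧
    (List.range 5).map (fun j => coeffXY gammaXY (2 * j) 4) = [0, 0, 0, 10, 145] ∧
    -- setting `y = x` gives the generating function by length
    MvPowerSeries.subst (fun _ : Fin 2 => (PowerSeries.X : PowerSeries ℚ)) gammaXY = gammaX ∧
    (let x : PowerSeries ℚ := PowerSeries.X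
     ∃ R : PowerSeries ℚ,
       PowerSeries.constantCoeff R = 1 ∧
       R ^ 2 = -4 + 4 * (1 + x ^ 2)⁻¹ + ((1 + x) ^ 2)⁻¹ ∧
       gammaX = (1 / 2 : ℚ) • ((1 + x)⁻¹ - 2 * x ^ 2 * (1 + x) - R)) ∧
    (List.range 15).map (fun n => PowerSeries.coeff n gammaX) =
      [0, 0, 0, 0, 0, 2, 4, 6, 15, 31, 67, 155, 343, 787, 1829] := by
  obtain ⟨Z, hZ0, hA, hZ⟩ := exists_word_series
  obtain ⟨z, hz0, hz, hgz⟩ := exists_gammaX_eq_sub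
  obtain ⟨h0, h1, h2, h3, h4⟩ := coeffXY_gammaXY_values
  refine ⟨?_, fun i k hi => coeffXY_gammaXY_of_odd hi k, h0, h1, h2, h3, h4, subst_gammaXY, ?_, ?_⟩
  · intro x y
    have hc : (1 + x ^ 2)⁻¹ * (1 + x ^ 2) = 1 := MvPowerSeries.inv_mul_cancel _ (by simp [x])
    have hd : (1 + y)⁻¹ * (1 + y) = 1 := MvPowerSeries.inv_mul_cancel _ (by simp [y])
    refine ⟨(1 + y)⁻¹ - 2 * Z, ?_, ?_, ?_⟩
    · simp [hZ0, y]
    · rw [sq_sub_two_mul_eq hc hd hZ, pow_two (1 + y), MvPowerSeries.mul_inv_rev, ← pow_two]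
    · rw [gammaXY_eq_sub hA, show (1 + y)⁻¹ - 2 * x ^ 2 * (1 + y) - ((1 + y)⁻¹ - 2 * Z) =
        (2 : ℕ) • (Z - x ^ 2 * y ^ 0 - x ^ 2 * y ^ 1) by simp; ring, ← Nat.cast_smul_eq_nsmul ℚ,
        smul_smul]
      norm_num [x, y]
  · intro x
    have hc : (1 + x ^ 2)⁻¹ * (1 + x ^ 2) = 1 := PowerSeries.inv_mul_cancel _ (by simp [x])
    have hd : (1 + x)⁻¹ * (1 + x) = 1 := PowerSeries.inv_mul_cancel _ (by simp [x])
    refine ⟨(1 + x)⁻¹ - 2 * z, ?_, ?_, ?_⟩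
    · simp [hz0, x]
    · rw [sq_sub_two_mul_eq hc hd hz, pow_two (1 + x), PowerSeries.mul_inv_rev, ← pow_two]
    · rw [hgz, show (1 + x)⁻¹ - 2 * x ^ 2 * (1 + x) - ((1 + x)⁻¹ - 2 * z) =
        (2 : ℕ) • (z - x ^ 2 - x ^ 3) by simp; ring, ← Nat.cast_smul_eq_nsmul ℚ, smul_smul]
      norm_num [x]
  · have h (n : ℕ) (hn : n < 15) : PowerSeries.coeff n gammaX =
        PowerSeries.coeff n (wordTrunc PowerSeries.X - PowerSeries.X ^ 2 - PowerSeries.X ^ 3) := by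
      rw [hgz, map_sub, map_sub, coeff_eq_coeff_wordTrunc hz0 hz hn, ← map_sub, ← map_sub]
    simp [List.range_succ, h, wordTrunc, PowerSeries.coeff_X_pow, -nsmul_eq_mul, map_nsmul]
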